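/- Let $\{C, D(k);\,k\ge 1\}$ be the parameters of a batch Markovian arrival process (BMAP) $(N(t),J(t))_{t\ge0}$ with finite phase set $\{1,\dots,M\}$: $[C]_{i,i}<0$, $[C]_{i,j}\ge0$ for $i\ne j$, $D(k)\ge O$, $D:=\sum_{k\ge1}D(k)$ converges, $(C+D)e=0$ (with $e$ the vector of ones), and $C+D$ is irreducible. Here $N(0)=0$, and the increments of $N$ together with the phase $J$ evolve as a time-homogeneous Markov process such that, as $t\downarrow0$, $\mathbb P(N(t)=0,J(t)=j\mid J(0)=i)=\delta_{i,j}+[C]_{i,j}t+o(t)$ and $\mathbb P(N(t)=k,J(t)=j\mid J(0)=i)=[D(k)]_{i,j}t+o(t)$ for $k\ge1$. Let $\pi$ be the stationary probability vector of $C+D$ and assume that $\lambda:=\pi\sum_{k\ge1}kD(k)e>0$. Let the service time $T\ge0$ be independent of the BMAP with mean $h=\mathbb E[T]\in(0,\infty)$, put $\rho=\lambda h$ and $$[A(k)]_{i,j}=\mathbb P(N(T)=k,\,J(T)=j\mid J(0)=i),\qquad k\ge0,$$ and let $T_{\mathrm e}\ge0$ have distribution $\mathbb P(T_{\mathrm e}\le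 x)=\frac1h\int_0^x\mathbb P(T>y)\,dy$, $x\ge0$. For a matrix sequence write $\overline M(k)=\sum_{l\ge k+1}M(l)$ and $\overline{\overline M}(k)=\sum_{l\ge k+1}\overline M(l)$. A nonnegative random variable $U$ with $\mathbb P(U>x)>0$ for all $x\ge0$ is long-tailed ($U\in\mathcal L$) if $\mathbb P(U>x+y)/\mathbb P(U>x)\to1$ as $x\to\infty$ for some $y>0$, and subexponential ($U\in\mathcal S$) if $\mathbb P(U_1+U_2>x)/\mathbb P(U>x)\to2$ as $x\to\infty$ for independent copies $U_1,U_2$ of $U$. Suppose that $\sqrt{T_{\mathrm e}}\in\mathcal L$, that $T_{\mathrm e}\in\mathcal S$, and that for some $\delta>0$ the matrices $e^{\delta\sqrt k}\,\overline D(k)$, $k\ge0$, are bounded. Then $\lambda T_{\mathrm e}\in\mathcal S$ and $$\lim_{k\to\infty}\frac{\overline{\overline A}(k)e}{\mathbb P(\lambda T_{\mathrm e}>k)}=\rho e .$$ Moreover the $\mathbb Z_+$-valued random variable $Y=\lfloor\lambda T_{\mathrm e}\rfloor$ satisfies $Y\in\mathcal S$ and $\lim_{k\to\infty}\overline{\overline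 A}(k)e/\mathbb P(Y>k)=\rho e$, where $\rho e\ge0$ and $\rho e\neq0$. These hypotheses do not force the batch sizes to be light-tailed: there are parameters $\{C,D(k)\}$ and a service time distribution that satisfy all of them, with $\rho<1$, and for which $\sum_{k}z^kD(k)$ diverges for every $z>1$. -/

import Mathlib

open Filter Topology MeasureTheory Set
open scoped NNReal ENNReal Matrix

/-! Distribution classes. Distributions of nonnegative random variables are measures on `ℝ`. -/

/-- The tail `ℙ(U > x)` of a random variable `U` with law `μ`. -/
noncomputable def tailProb (μ : Measure ℝ) (x : ℝ) : ℝ := μ.real (Set.Ioi x)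

/-- Membership of a law in the class `𝓛` of long-tailed distributions on `[0, ∞)`. -/
structure IsLongTailed (μ : Measure ℝ) : Prop where
  prob : IsProbabilityMeasure μ
  nonneg : μ (Set.Iio 0) = 0
  tail_pos : ∀ x : ℝ, 0 ≤ x → 0 < tailProb μ x
  tendsto_ratio : ∃ y : ℝ, 0 < y ∧
    Tendsto (fun x : ℝ => tailProb μ (x + y) / tailProb μ x) atTop (𝓝 1)

/-- Membership of a law in the class `𝓢` of subexponential distributions on `[0, ∞)`.
`μ.conv μ` is the law of the sum of two independent copies. -/
structure IsSubexponential (μ : Measure ℝ) : Prop where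
  prob : IsProbabilityMeasure μ
  nonneg : μ (Set.Iio 0) = 0
  tail_pos : ∀ x : ℝ, 0 ≤ x → 0 < tailProb μ x
  tendsto_ratio : Tendsto (fun x : ℝ => tailProb (μ.conv μ) x / tailProb μ x) atTop (𝓝 2)

/-! Matrix sequences. -/

/-- `M̄(k) = ∑_{l ≥ k+1} M(l)`. The double tail is `seqTail (seqTail M)`. -/
noncomputable def seqTail {m : ℕ} (M : ℕ → Matrix (Fin m) (Fin m) ℝ) (k : ℕ) :
    Matrix (Fin m) (Fin m) ℝ :=
  ∑' l : ℕ, M (k + 1 + l)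

/-! The batch Markovian arrival process. -/

/-- Admissible parameters of a BMAP `{C, D(k); k ≥ 1}` with irreducible background generator
`C + ∑ D(k)`. The sequence `D` starts at index `1`; the unused entry `D 0` is set to zero. -/
structure IsBMAPParam {m : ℕ} (C : Matrix (Fin m) (Fin m) ℝ)
    (D : ℕ → Matrix (Fin m) (Fin m) ℝ) : Prop where
  C_diag : ∀ i, C i i < 0
  C_offDiag : ∀ i j, i ≠ j → 0 ≤ C i j
  D_nonneg : ∀ k i j, 0 ≤ D k i j
  D_zero : D 0 = 0
  D_summable : Summable D
  row_sum : (C + ∑' k, D k) *ᵥ 1 = 0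
  irreducible : ∀ i j, Relation.ReflTransGen (fun a b => 0 < (C + ∑' k, D k) a b) i j

/-- `p` is a stationary probability vector of the generator `Q`. -/
structure IsStationaryVector {m : ℕ} (Q : Matrix (Fin m) (Fin m) ℝ) (p : Fin m → ℝ) : Prop where
  nonneg : ∀ i, 0 ≤ p i
  sum_one : ∑ i, p i = 1
  stationary : p ᵥ* Q = 0

/-- The mean arrival rate `λ = π ∑_k k D(k) e`. -/
noncomputable def arrivalRate {m : ℕ} (p : Fin m → ℝ) (D : ℕ → Matrix (Fin m) (Fin m) ℝ) : ℝ :=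
  p ⬝ᵥ ((∑' k : ℕ, (k : ℝ) • D k) *ᵥ 1)

/-- The sigma-algebra generated by `(N(r), J(r))`, `r ≤ s`. -/
def bmapHistory {Ω : Type*} {m : ℕ} (N : ℝ≥0 → Ω → ℕ) (J : ℝ≥0 → Ω → Fin m) (s : ℝ≥0) :
    MeasurableSpace Ω :=
  ⨆ (r : ℝ≥0) (_ : r ≤ s), MeasurableSpace.comap (fun ω => (N r ω, J r ω)) inferInstance

/-- `(N(t), J(t))` is a BMAP `{C, D(k)}`; `P i` is the conditional law given `J(0) = i`.
The increments of `N` and the phase `J` form a time-homogeneous Markov process whose transition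
probabilities over a short time `t` are `δ + C t + o(t)` (no arrival) and `D(k) t + o(t)`
(a batch of size `k ≥ 1`). Joint measurability makes `N(T)`, `J(T)` random variables. -/
structure IsBMAP {Ω : Type*} [MeasurableSpace Ω] {m : ℕ} (C : Matrix (Fin m) (Fin m) ℝ)
    (D : ℕ → Matrix (Fin m) (Fin m) ℝ) (P : Fin m → Measure Ω)
    (N : ℝ≥0 → Ω → ℕ) (J : ℝ≥0 → Ω → Fin m) : Prop where
  prob : ∀ i, IsProbabilityMeasure (P i)
  measurable_N : Measurable fun q : Ω × ℝ≥0 => N q.2 q.1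
  measurable_J : Measurable fun q : Ω × ℝ≥0 => J q.2 q.1
  initial : ∀ i, ∀ᵐ ω ∂(P i), N 0 ω = 0 ∧ J 0 ω = i
  markov : ∀ (i : Fin m) (s t : ℝ≥0) (F : Set Ω), MeasurableSet[bmapHistory N J s] F →
    ∀ (a j : Fin m) (k : ℕ),
      P i (F ∩ {ω | J s ω = a} ∩ {ω | N (s + t) ω = N s ω + k ∧ J (s + t) ω = j}) =
        P i (F ∩ {ω | J s ω = a}) * P a {ω | N t ω = k ∧ J t ω = j}
  infinitesimal : ∀ (i j : Fin m) (k : ℕ),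
    Tendsto
      (fun t : ℝ≥0 =>
        ((P i).real {ω | N t ω = k ∧ J t ω = j} - (if k = 0 ∧ i = j then 1 else 0)) / (t : ℝ))
      (𝓝[>] 0) (𝓝 (if k = 0 then C i j else D k i j))

/-! The service time. -/

/-- `H` is a service time distribution on `[0, ∞)` with mean in `(0, ∞)`. -/
structure IsServiceLaw (H : Measure ℝ≥0) : Prop where
  prob : IsProbabilityMeasure H
  integrable : Integrable (fun t : ℝ≥0 => (t : ℝ)) H
  mean_pos : 0 < ∫ t : ℝ≥0, (t : ℝ) ∂H

/-- The mean service time `h`. -/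
noncomputable def meanService (H : Measure ℝ≥0) : ℝ := ∫ t : ℝ≥0, (t : ℝ) ∂H

/-- The law of the equilibrium service time `T_e`: density `ℙ(T > y) / h` on `[0, ∞)`. -/
noncomputable def equilibriumLaw (H : Measure ℝ≥0) : Measure ℝ :=
  (volume.restrict (Set.Ici (0 : ℝ))).withDensity
    (fun y => ENNReal.ofReal (H.real {t : ℝ≥0 | y < (t : ℝ)} / meanService H))

/-- `[A(k)]_{i,j} = ℙ(N(T) = k, J(T) = j | J(0) = i)`, where the service time `T` has law `H` and
is independent of the BMAP: it is the second coordinate of `Ω × [0, ∞)` under `P i × H`. -/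
noncomputable def serviceArrivals {Ω : Type*} [MeasurableSpace Ω] {m : ℕ} (P : Fin m → Measure Ω)
    (N : ℝ≥0 → Ω → ℕ) (J : ℝ≥0 → Ω → Fin m) (H : Measure ℝ≥0) (k : ℕ) :
    Matrix (Fin m) (Fin m) ℝ :=
  fun i j => ((P i).prod H).real {q : Ω × ℝ≥0 | N q.2 q.1 = k ∧ J q.2 q.1 = j}

/-! The assumption that is to be verified. -/

/-- `lim_k A̿(k) e / ℙ(Y > k) = c`, where `Y` has law `μ`. -/
def HasDoubleTailLimit {m : ℕ} (A : ℕ → Matrix (Fin m) (Fin m) ℝ) (μ : Measure ℝ)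
    (c : Fin m → ℝ) : Prop :=
  ∀ i, Tendsto (fun k : ℕ => (seqTail (seqTail A) k *ᵥ 1) i / tailProb μ (k : ℝ)) atTop (𝓝 (c i))

/-- The assumption on `{A(k)}` for the `ℤ₊`-valued random variable `Y` with law `ν`
and the vector `c`. -/
structure SubexpAssumption {m : ℕ} (A : ℕ → Matrix (Fin m) (Fin m) ℝ) (ν : Measure ℕ)
    (c : Fin m → ℝ) : Prop where
  subexp : IsSubexponential (ν.map (fun n : ℕ => (n : ℝ)))
  limit : HasDoubleTailLimit A (ν.map (fun n : ℕ => (n : ℝ))) c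
  nonneg : ∀ i, 0 ≤ c i
  ne_zero : c ≠ 0

/-! The hypotheses on the data. -/

/-- For some `δ > 0`, the matrices `e^{δ √k} D̄(k)` (which are nonnegative) are bounded in `k`. -/
def BatchTailBound {m : ℕ} (D : ℕ → Matrix (Fin m) (Fin m) ℝ) : Prop :=
  ∃ δ : ℝ, 0 < δ ∧ ∃ K : ℝ, ∀ (k : ℕ) (i j : Fin m),
    Real.exp (δ * Real.sqrt k) * seqTail D k i j ≤ K

/-- `{D(k)}` is light-tailed: `∑ z^k D(k)` converges for some `z > 1`. -/
def IsLightTailedSeq {m : ℕ} (D : ℕ → Matrix (Fin m) (Fin m) ℝ) : Prop :=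
  ∃ z : ℝ, 1 < z ∧ Summable (fun k : ℕ => z ^ k • D k)

/-- All conditions on the data: BMAP parameters, stationary phase vector `p`, `λ > 0`, service law,
`√T_e ∈ 𝓛`, `T_e ∈ 𝓢` and the bound on the batch tails. -/
structure SubexpHypotheses {m : ℕ} (C : Matrix (Fin m) (Fin m) ℝ)
    (D : ℕ → Matrix (Fin m) (Fin m) ℝ) (p : Fin m → ℝ) (H : Measure ℝ≥0) : Prop where
  bmap : IsBMAPParam C D
  stationary : IsStationaryVector (C + ∑' k, D k) p
  rate_pos : 0 < arrivalRate p D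
  service : IsServiceLaw H
  sqrt_longTailed : IsLongTailed ((equilibriumLaw H).map Real.sqrt)
  batch : BatchTailBound D
  equilibrium_subexp : IsSubexponential (equilibriumLaw H)

/-!
The double tail is a mean excess: its row `i` equals `𝔼ᵢ[(N(T) - k - 1)⁺]`, while
`ρ ℙ(λ T_e > k) = 𝔼[(λ T - k)⁺]`. So the claim is that the fluctuations of `N(t)` around `λ t` do
not matter for the mean excess at the level `k`. They are of order `√k` for the relevant `t`, and
`√T_e ∈ 𝓛` says exactly that the mean excess `G(k) = 𝔼[(λ T - k)⁺]` is insensitive to shifts of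
that order (`tendsto_meanExcess_sq`).

*Moment bounds.* From the Chapman–Kolmogorov equation and the infinitesimal description one gets the
forward equation for the finitely many probabilities `ℙ(N(t) = n, J(t) = j)`, `n ≤ K`, and with
Grönwall's inequality a drift criterion for nonnegative test functions
(`IsBMAP.lintegral_le_of_drift`). Test functions `u(n) (1 + τ w j)`, where `w` solves the Poisson
equation `(C + D) w = λ e - ∑ k D(k) e`, have drift `τ λ + O(τ²)` (`IsBMAPParam.drift_le`). With
`u(n) = e^{-θ n}`, `θ → 0`, this gives `𝔼ᵢ N(t) ≥ λ t - c`. With the convex function `linExp` at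
`θ = η / √s` it gives, for `λ t ≤ s`,
`𝔼ᵢ (N(t) - x)⁺ ≤ A √s e^{-η (x - λ t) / √s} + A t e^{-η √s}`
(`IsBMAP.exists_lintegral_sub_le`): the exponential growth of `linExp` handles batches of size at
most `s`, for which `θ l ≤ η √l` is absorbed by the tail `e^{-δ √l}`, and its linear growth handles
the larger ones.

*Integration over the service time.* The lower bound for the double tail is `G(k + 1 + c)`. The upper
bound is `G(k) (1 + A / √k)` plus a multiple of `r 𝔼[min(1, e^{-η (r - √(λ T))})]` at `r = √k`. The
latter is `o(G(k))`: passing from `r` to `r + 1` contracts it by `e^{-η}`, up to new mass that is an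
increment of `r ↦ G(r²)` (`smoothTail_add_one_le`, `tendsto_smoothTail_div`).

*Heavy batches.* For the example there is a single phase, `D(k) = e^{-√k}`, and a Pareto service
time, for which `ℙ(T_e > x) = a / (a + x)` is subexponential by the one-big-jump argument.
-/

/-! ### Matrix series and summability of stretched exponentials -/

theorem matrix_summable_iff {m : ℕ} {f : ℕ → Matrix (Fin m) (Fin m) ℝ} :
    Summable f ↔ ∀ i j, Summable fun k => f k i j :=
  Pi.summable.trans (forall_congr' fun _ => Pi.summable)

theorem matrix_tsum_apply {m : ℕ} {f : ℕ → Matrix (Fin m) (Fin m) ℝ} (hf : Summable f)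
    (i j : Fin m) : (∑' k, f k) i j = ∑' k, f k i j := by
  have h1 : (∑' k, f k) i = ∑' k, f k i := tsum_apply hf
  rw [h1]
  exact tsum_apply (Pi.summable.1 hf i)

theorem summable_pow_mul_exp_neg_sqrt (a : ℕ) {ε : ℝ} (hε : 0 < ε) :
    Summable fun k : ℕ => (k : ℝ) ^ a * Real.exp (-ε * Real.sqrt k) := by
  have h0 : Tendsto (fun x : ℝ => x ^ (2 * a + 4) * Real.exp (-ε * x)) atTop (𝓝 0) := by
    have h1 := (Real.tendsto_pow_mul_exp_neg_atTop_nhds_zero (2 * a + 4)).comp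
      (tendsto_id.const_mul_atTop hε)
    have h2 := h1.const_mul ((ε ^ (2 * a + 4))⁻¹)
    rw [mul_zero] at h2
    refine h2.congr fun x => ?_
    simp only [Function.comp, id, mul_pow]
    field_simp
  have h1 : Tendsto (fun k : ℕ => Real.sqrt k) atTop atTop :=
    Real.tendsto_sqrt_atTop.comp tendsto_natCast_atTop_atTop
  have h2 := h0.comp h1
  have h3 : (fun k : ℕ => (k : ℝ) ^ a * Real.exp (-ε * Real.sqrt k)) =O[atTop]
      fun k : ℕ => 1 / (k : ℝ) ^ 2 := by
    refine Asymptotics.IsBigO.of_bound 1 ?_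
    filter_upwards [h2.eventually (gt_mem_nhds one_pos), eventually_ge_atTop 1] with k hk hk1
    have hk0 : (0 : ℝ) < k := by exact_mod_cast hk1
    simp only [Function.comp] at hk
    have e : Real.sqrt k ^ (2 * a + 4) = (k : ℝ) ^ a * (k : ℝ) ^ 2 := by
      rw [show 2 * a + 4 = 2 * (a + 2) by ring, pow_mul, Real.sq_sqrt hk0.le, pow_add]
    rw [e] at hk
    rw [Real.norm_of_nonneg (by positivity), Real.norm_of_nonneg (by positivity), one_mul,
      le_div_iff₀ (by positivity)]
    linarith
  exact summable_of_isBigO_nat (Real.summable_one_div_nat_pow.2 one_lt_two) h3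

/-! ### The Poisson equation of an irreducible generator -/

/-- Maximum principle: a vector in the kernel of an irreducible generator is constant. -/
theorem eq_of_generator_mulVec_eq_zero {m : ℕ} {Q : Matrix (Fin m) (Fin m) ℝ}
    (hoff : ∀ i j, i ≠ j → 0 ≤ Q i j) (hrow : Q *ᵥ 1 = 0)
    (hirr : ∀ i j, Relation.ReflTransGen (fun a b => 0 < Q a b) i j) {v : Fin m → ℝ}
    (hv : Q *ᵥ v = 0) (i j : Fin m) : v i = v j := by
  have : Nonempty (Fin m) := ⟨i⟩
  obtain ⟨a, ha⟩ := Finite.exists_max v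
  have key : ∀ b c, 0 < Q b c → v b = v a → v c = v a := by
    intro b c hbc hb
    have h1 : ∑ x, Q b x * (v b - v x) = 0 := by
      have e1 := congrFun hv b
      have e2 := congrFun hrow b
      simp only [Matrix.mulVec, dotProduct, Pi.one_apply, mul_one, Pi.zero_apply] at e1 e2
      simp only [mul_sub, Finset.sum_sub_distrib, ← Finset.sum_mul, e1, e2]
      ring
    have h2 : ∀ x ∈ Finset.univ, 0 ≤ Q b x * (v b - v x) := by
      intro x _
      by_cases hx : b = x
      · simp [hx]
      · exact mul_nonneg (hoff b x hx) (by rw [hb]; linarith [ha x])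
    have h3 := (Finset.sum_eq_zero_iff_of_nonneg h2).1 h1 c (Finset.mem_univ c)
    rcases mul_eq_zero.1 h3 with h | h
    · exact absurd h hbc.ne'
    · linarith
  have all : ∀ c, v c = v a := by
    intro c
    induction hirr a c with
    | refl => rfl
    | tail _ hbc ih => exact key _ _ hbc ih
  rw [all i, all j]

/-- Solvability of the Poisson equation: every vector orthogonal to the stationary vector lies in
the range of an irreducible generator. -/
theorem exists_generator_mulVec_eq {m : ℕ} {Q : Matrix (Fin m) (Fin m) ℝ}
    (hoff : ∀ i j, i ≠ j → 0 ≤ Q i j) (hrow : Q *ᵥ 1 = 0)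
    (hirr : ∀ i j, Relation.ReflTransGen (fun a b => 0 < Q a b) i j) {p : Fin m → ℝ}
    (hp : IsStationaryVector Q p) {x : Fin m → ℝ} (hx : p ⬝ᵥ x = 0) : ∃ w, Q *ᵥ w = x := by
  have hp0 : p ≠ 0 := by
    rintro rfl
    simpa using hp.sum_one
  have : Nonempty (Fin m) := by
    by_contra h
    rw [not_nonempty_iff] at h
    exact hp0 (Subsingleton.elim _ _)
  let φ : (Fin m → ℝ) →ₗ[ℝ] ℝ := dotProductBilin ℝ ℝ p
  have hφ : ∀ y, φ y = p ⬝ᵥ y := fun y => rfl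
  have hle : LinearMap.range Q.mulVecLin ≤ LinearMap.ker φ := by
    rintro _ ⟨y, rfl⟩
    rw [LinearMap.mem_ker, hφ, Matrix.mulVecLin_apply, Matrix.dotProduct_mulVec, hp.stationary,
      zero_dotProduct]
  have hker : Module.finrank ℝ (LinearMap.ker Q.mulVecLin) ≤ 1 := by
    refine finrank_le_one (⟨1, by simpa using hrow⟩ : LinearMap.ker Q.mulVecLin) ?_
    rintro ⟨v, hv⟩
    obtain ⟨a⟩ := ‹Nonempty (Fin m)›
    refine ⟨v a, Subtype.ext (funext fun b => ?_)⟩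
    have := eq_of_generator_mulVec_eq_zero hoff hrow hirr (by simpa using hv) a b
    simpa using this
  have hrange : LinearMap.range φ = ⊤ := by
    rw [LinearMap.range_eq_top]
    refine LinearMap.surjective ?_
    intro h
    refine hp0 (dotProduct_eq_zero p fun y => ?_)
    rw [← hφ, h]; rfl
  have h1 := LinearMap.finrank_range_add_finrank_ker Q.mulVecLin
  have h2 := LinearMap.finrank_range_add_finrank_ker φ
  rw [hrange, finrank_top, Module.finrank_self] at h2
  have h3 := Submodule.finrank_mono hle
  have heq := Submodule.eq_of_le_of_finrank_eq hle (by omega)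
  have hmem : x ∈ LinearMap.range Q.mulVecLin := by rw [heq, LinearMap.mem_ker, hφ, hx]
  obtain ⟨w, hw⟩ := hmem
  exact ⟨w, by simpa using hw⟩

/-! ### Stretched exponential decay of the batch rates -/

/-- The bound on the batch tails, stated for the rates themselves. -/
theorem BatchTailBound.exists_rate_le {m : ℕ} {C : Matrix (Fin m) (Fin m) ℝ}
    {D : ℕ → Matrix (Fin m) (Fin m) ℝ} (hD : IsBMAPParam C D) (hb : BatchTailBound D) :
    ∃ δ : ℝ, 0 < δ ∧ ∃ K : ℝ, 0 ≤ K ∧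
      ∀ k i j, D k i j ≤ K * Real.exp (-δ * Real.sqrt k) := by
  obtain ⟨δ, hδ, K, hK⟩ := hb
  refine ⟨δ, hδ, max K 0 * Real.exp δ, by positivity, fun k i j => ?_⟩
  rcases k with _ | k
  · simp only [hD.D_zero, Matrix.zero_apply]
    positivity
  · have hs : Summable fun l => D (k + 1 + l) := by
      simpa [add_comm] using (summable_nat_add_iff (k + 1)).2 hD.D_summable
    have h1 : D (k + 1) i j ≤ seqTail D k i j := by
      rw [seqTail, matrix_tsum_apply hs]
      exact (matrix_summable_iff.1 hs i j).le_tsum 0 fun l _ => hD.D_nonneg _ _ _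
    have h2 := hK k i j
    have h3 : Real.sqrt (k + 1 : ℕ) ≤ Real.sqrt k + 1 := by
      rw [Real.sqrt_le_left (by positivity)]
      push_cast
      nlinarith [Real.sq_sqrt (Nat.cast_nonneg (α := ℝ) k), Real.sqrt_nonneg (k : ℝ)]
    have h4 : seqTail D k i j ≤ max K 0 * Real.exp (-(δ * Real.sqrt k)) := by
      rw [Real.exp_neg, ← div_eq_mul_inv, le_div_iff₀ (Real.exp_pos _), mul_comm]
      exact h2.trans (le_max_left _ _)
    refine h1.trans (h4.trans ?_)
    rw [mul_assoc, ← Real.exp_add]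
    gcongr
    nlinarith

theorem IsBMAPParam.summable_mul {m : ℕ} {C : Matrix (Fin m) (Fin m) ℝ}
    {D : ℕ → Matrix (Fin m) (Fin m) ℝ} (hD : IsBMAPParam C D) {δ K : ℝ}
    (hK : ∀ k i j, D k i j ≤ K * Real.exp (-δ * Real.sqrt k)) (a : ℕ) {η : ℝ} (hη : η < δ)
    (i j : Fin m) :
    Summable fun k : ℕ => (k : ℝ) ^ a * Real.exp (η * Real.sqrt k) * D k i j := by
  refine Summable.of_nonneg_of_le (fun k => ?_) (fun k => ?_)
    ((summable_pow_mul_exp_neg_sqrt a (sub_pos.2 hη)).mul_left K)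
  · have := hD.D_nonneg k i j
    positivity
  · calc (k : ℝ) ^ a * Real.exp (η * Real.sqrt k) * D k i j
        ≤ (k : ℝ) ^ a * Real.exp (η * Real.sqrt k) * (K * Real.exp (-δ * Real.sqrt k)) := by
          gcongr; exact hK k i j
      _ = K * ((k : ℝ) ^ a * (Real.exp (η * Real.sqrt k) * Real.exp (-δ * Real.sqrt k))) := by ring
      _ = _ := by
          rw [← Real.exp_add]
          ring_nf

theorem IsBMAPParam.offDiag_nonneg {m : ℕ} {C : Matrix (Fin m) (Fin m) ℝ}
    {D : ℕ → Matrix (Fin m) (Fin m) ℝ} (hD : IsBMAPParam C D) (i j : Fin m) (hij : i ≠ j) :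
    0 ≤ (C + ∑' k, D k) i j := by
  rw [Matrix.add_apply, matrix_tsum_apply hD.D_summable]
  exact add_nonneg (hD.C_offDiag i j hij) (tsum_nonneg fun k => hD.D_nonneg k i j)

/-- The phase corrector: the solution of the Poisson equation that removes the phase dependence of
the mean drift. -/
theorem IsBMAPParam.exists_corrector {m : ℕ} {C : Matrix (Fin m) (Fin m) ℝ}
    {D : ℕ → Matrix (Fin m) (Fin m) ℝ} (hD : IsBMAPParam C D) {p : Fin m → ℝ}
    (hp : IsStationaryVector (C + ∑' k, D k) p) :
    ∃ w : Fin m → ℝ, ∀ i, ((C + ∑' k, D k) *ᵥ w) i =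
      arrivalRate p D - ((∑' k : ℕ, (k : ℝ) • D k) *ᵥ 1) i := by
  have := exists_generator_mulVec_eq hD.offDiag_nonneg hD.row_sum hD.irreducible hp
    (x := fun i => arrivalRate p D - ((∑' k : ℕ, (k : ℝ) • D k) *ᵥ 1) i) (by
      simp only [dotProduct, mul_sub, Finset.sum_sub_distrib, ← Finset.sum_mul, hp.sum_one, one_mul]
      rw [sub_eq_zero]
      rfl)
  obtain ⟨w, hw⟩ := this
  exact ⟨w, fun i => congrFun hw i⟩

/-! ### The transition semigroup of the counting process -/

/-- The transition probability `ℙ(N(t) = n, J(t) = j | J(0) = i)`. -/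
noncomputable def transProb {Ω : Type*} [MeasurableSpace Ω] {m : ℕ} (P : Fin m → Measure Ω)
    (N : ℝ≥0 → Ω → ℕ) (J : ℝ≥0 → Ω → Fin m) (t : ℝ≥0) (n : ℕ) (i j : Fin m) : ℝ :=
  (P i).real {ω | N t ω = n ∧ J t ω = j}

/-- The rate of jumps of size `l` with phase change `i → j`. The entry at `l = 0` is `C`, because
`D 0 = 0`. -/
def jumpRate {m : ℕ} (C : Matrix (Fin m) (Fin m) ℝ) (D : ℕ → Matrix (Fin m) (Fin m) ℝ)
    (l : ℕ) (i j : Fin m) : ℝ :=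
  D l i j + if l = 0 then C i j else 0

theorem measure_eq_tsum_inter_fiber {Ω β : Type*} [MeasurableSpace Ω] [MeasurableSpace β]
    [Countable β] [MeasurableSingletonClass β] (μ : Measure Ω) {f : Ω → β} (hf : Measurable f)
    {S : Set Ω} (hS : MeasurableSet S) : μ S = ∑' z, μ (S ∩ f ⁻¹' {z}) := by
  have e : S = ⋃ z, S ∩ f ⁻¹' {z} := by
    ext ω
    simp
  conv_lhs => rw [e]
  refine measure_iUnion (fun a b hab => ?_) fun z => hS.inter (hf (measurableSet_singleton z))
  rw [Function.onFun, Set.disjoint_left]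
  rintro ω ⟨_, h1⟩ ⟨_, h2⟩
  exact hab (h1.symm.trans h2)

namespace IsBMAP

variable {Ω : Type*} [MeasurableSpace Ω] {m : ℕ} {C : Matrix (Fin m) (Fin m) ℝ}
  {D : ℕ → Matrix (Fin m) (Fin m) ℝ} {P : Fin m → Measure Ω}
  {N : ℝ≥0 → Ω → ℕ} {J : ℝ≥0 → Ω → Fin m}

theorem measurable_N_apply (h : IsBMAP C D P N J) (t : ℝ≥0) : Measurable (N t) :=
  h.measurable_N.comp (measurable_id.prodMk measurable_const)

theorem measurable_J_apply (h : IsBMAP C D P N J) (t : ℝ≥0) : Measurable (J t) :=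
  h.measurable_J.comp (measurable_id.prodMk measurable_const)

theorem measurable_pair (h : IsBMAP C D P N J) (t : ℝ≥0) :
    Measurable fun ω => (N t ω, J t ω) :=
  (h.measurable_N_apply t).prodMk (h.measurable_J_apply t)

theorem transProb_nonneg (t : ℝ≥0) (n : ℕ) (i j : Fin m) : 0 ≤ transProb P N J t n i j :=
  measureReal_nonneg

theorem sum_transProb_le_one (h : IsBMAP C D P N J) (t : ℝ≥0) (K : ℕ) (i : Fin m) :
    ∑ n ∈ Finset.range K, ∑ j, transProb P N J t n i j ≤ 1 := by
  have := h.prob i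
  rw [← Finset.sum_product']
  have e : ∀ z : ℕ × Fin m, transProb P N J t z.1 i z.2 =
      (P i).real ((fun ω => (N t ω, J t ω)) ⁻¹' {z}) := by
    rintro ⟨n, j⟩
    simp only [transProb]
    congr 1
    ext ω
    simp
  simp only [e]
  rw [sum_measureReal_preimage_singleton _
    fun z _ => h.measurable_pair t (measurableSet_singleton z)]
  exact measureReal_le_one

/-- The counting process does not decrease: the transition probabilities in the Markov property
already account for the full mass. -/
theorem ae_le_add (h : IsBMAP C D P N J) (i : Fin m) (s t : ℝ≥0) :
    ∀ᵐ ω ∂(P i), N s ω ≤ N (s + t) ω := by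
  have := h.prob
  have hM : MeasurableSet {ω | N s ω ≤ N (s + t) ω} :=
    measurableSet_le (h.measurable_N_apply s) (h.measurable_N_apply (s + t))
  have key : ∀ a, P i ({ω | N s ω ≤ N (s + t) ω} ∩ J s ⁻¹' {a}) = P i (J s ⁻¹' {a}) := by
    intro a
    have hf : Measurable fun ω => (N (s + t) ω - N s ω, J (s + t) ω) :=
      ((h.measurable_N_apply _).sub (h.measurable_N_apply _)).prodMk (h.measurable_J_apply _)
    rw [measure_eq_tsum_inter_fiber (P i) hf
      (hM.inter (h.measurable_J_apply s (measurableSet_singleton a)))]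
    have e : ∀ z : ℕ × Fin m, P i ({ω | N s ω ≤ N (s + t) ω} ∩ J s ⁻¹' {a} ∩
        (fun ω => (N (s + t) ω - N s ω, J (s + t) ω)) ⁻¹' {z}) =
        P i (J s ⁻¹' {a}) * P a (univ ∩ (fun ω => (N t ω, J t ω)) ⁻¹' {z}) := by
      rintro ⟨k, j⟩
      have h1 := h.markov i s t univ MeasurableSet.univ a j k
      simp only [univ_inter] at h1
      have e1 : {ω | N s ω ≤ N (s + t) ω} ∩ J s ⁻¹' {a} ∩
          (fun ω => (N (s + t) ω - N s ω, J (s + t) ω)) ⁻¹' {(k, j)} =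
          {ω | J s ω = a} ∩ {ω | N (s + t) ω = N s ω + k ∧ J (s + t) ω = j} := by
        ext ω
        simp only [mem_inter_iff, mem_ofPred_eq, mem_preimage, mem_singleton_iff, Prod.mk.injEq]
        constructor
        · rintro ⟨⟨h1, h2⟩, h3, h4⟩
          exact ⟨h2, by omega, h4⟩
        · rintro ⟨h2, h3, h4⟩
          exact ⟨⟨by omega, h2⟩, by omega, h4⟩
      rw [e1, h1, univ_inter]
      congr 2
      ext ω
      simp
    simp only [e]
    rw [ENNReal.tsum_mul_left, ← measure_eq_tsum_inter_fiber (P a) (h.measurable_pair t)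
      MeasurableSet.univ, measure_univ, mul_one]
  rw [ae_iff_prob_eq_one (by exact hM.mem) ]
  have h1 := measure_eq_tsum_inter_fiber (P i) (h.measurable_J_apply s) hM
  have h2 := measure_eq_tsum_inter_fiber (P i) (h.measurable_J_apply s) MeasurableSet.univ
  simp only [key] at h1
  simp only [univ_inter, measure_univ] at h2
  rw [h1, ← h2]

/-- The Chapman–Kolmogorov equation. -/
theorem transProb_add (h : IsBMAP C D P N J) (s t : ℝ≥0) (n : ℕ) (i j : Fin m) :
    transProb P N J (s + t) n i j = ∑ k ∈ Finset.range (n + 1), ∑ a,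
      transProb P N J s k i a * transProb P N J t (n - k) a j := by
  have := h.prob
  have hM : MeasurableSet {ω | N s ω ≤ N (s + t) ω} :=
    measurableSet_le (h.measurable_N_apply s) (h.measurable_N_apply (s + t))
  have hS : MeasurableSet ({ω | N (s + t) ω = n ∧ J (s + t) ω = j}) := by
    convert h.measurable_pair (s + t) (measurableSet_singleton (n, j)) using 1
    ext ω
    simp
  have e0 : P i {ω | N (s + t) ω = n ∧ J (s + t) ω = j} =
      P i ({ω | N (s + t) ω = n ∧ J (s + t) ω = j} ∩ {ω | N s ω ≤ N (s + t) ω}) := by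
    refine measure_congr ?_
    filter_upwards [h.ae_le_add i s t] with ω hω
    exact propext ⟨fun h1 => ⟨h1, hω⟩, fun h1 => h1.1⟩
  have e1 : P i {ω | N (s + t) ω = n ∧ J (s + t) ω = j} =
      ∑ k ∈ Finset.range (n + 1), ∑ a, P i {ω | N s ω = k ∧ J s ω = a} *
        P a {ω | N t ω = n - k ∧ J t ω = j} := by
    rw [e0, measure_eq_tsum_inter_fiber (P i) (h.measurable_pair s) (hS.inter hM),
      ENNReal.tsum_prod']
    simp only [tsum_fintype]
    rw [tsum_eq_sum (s := Finset.range (n + 1))]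
    · refine Finset.sum_congr rfl fun k hk => Finset.sum_congr rfl fun a _ => ?_
      have hF : MeasurableSet[bmapHistory N J s] {ω | N s ω = k} := by
        have h1 : MeasurableSpace.comap (fun ω => (N s ω, J s ω)) inferInstance ≤
            bmapHistory N J s :=
          le_iSup₂ (f := fun (r : ℝ≥0) (_ : r ≤ s) =>
            MeasurableSpace.comap (fun ω => (N r ω, J r ω)) inferInstance) s le_rfl
        exact h1 _ ⟨{k} ×ˢ univ, (measurableSet_singleton k).prod MeasurableSet.univ, by
          ext ω; simp⟩
      have h1 := h.markov i s t _ hF a j (n - k)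
      have hk' : k ≤ n := by simpa [Nat.lt_succ_iff] using hk
      have e2 : {ω | N s ω = k} ∩ {ω | J s ω = a} = {ω | N s ω = k ∧ J s ω = a} := rfl
      rw [e2] at h1
      rw [← h1]
      congr 1
      ext ω
      simp only [mem_inter_iff, mem_ofPred_eq, mem_preimage, mem_singleton_iff, Prod.mk.injEq]
      constructor
      · rintro ⟨⟨⟨h1, h2⟩, h3⟩, h4, h5⟩
        exact ⟨⟨h4, h5⟩, by omega, h2⟩
      · rintro ⟨⟨h4, h5⟩, h1, h2⟩
        exact ⟨⟨⟨by omega, h2⟩, by omega⟩, h4, h5⟩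
    · intro k hk
      refine Finset.sum_eq_zero fun a _ => ?_
      rw [Finset.mem_range, not_lt] at hk
      convert measure_empty (μ := P i)
      rw [Set.eq_empty_iff_forall_notMem]
      rintro ω ⟨⟨⟨h1, h2⟩, h3⟩, h4⟩
      simp only [mem_ofPred_eq, mem_preimage, mem_singleton_iff, Prod.mk.injEq] at h1 h3 h4
      omega
  simp only [transProb, measureReal_def]
  rw [e1, ENNReal.toReal_sum fun k _ => ENNReal.sum_ne_top.2 fun a _ =>
    ENNReal.mul_ne_top (measure_ne_top _ _) (measure_ne_top _ _)]
  refine Finset.sum_congr rfl fun k _ => ?_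
  rw [ENNReal.toReal_sum fun a _ => ENNReal.mul_ne_top (measure_ne_top _ _) (measure_ne_top _ _)]
  simp only [ENNReal.toReal_mul]

theorem transProb_zero (h : IsBMAP C D P N J) (n : ℕ) (i j : Fin m) :
    transProb P N J 0 n i j = if n = 0 ∧ i = j then 1 else 0 := by
  have := h.prob i
  have h1 : (P i).real {ω | N 0 ω = n ∧ J 0 ω = j} = (P i).real {_ω : Ω | n = 0 ∧ i = j} := by
    refine measureReal_congr ?_
    filter_upwards [h.initial i] with ω hω
    apply propext
    change (N 0 ω = n ∧ J 0 ω = j) ↔ (n = 0 ∧ i = j)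
    rw [hω.1, hω.2, eq_comm]
  rw [transProb, h1]
  by_cases hc : n = 0 ∧ i = j
  · have := h.prob j
    simp [hc]
  · simp only [hc, ofPred_false, measureReal_empty, if_false]

theorem tendsto_transProb_sub_div (h : IsBMAP C D P N J) (hD : D 0 = 0) (n : ℕ) (i j : Fin m) :
    Tendsto (fun t : ℝ≥0 => (transProb P N J t n i j - transProb P N J 0 n i j) / (t : ℝ))
      (𝓝[>] 0) (𝓝 (jumpRate C D n i j)) := by
  have h1 := h.infinitesimal i j n
  have e : (if n = 0 then C i j else D n i j) = jumpRate C D n i j := by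
    by_cases hn : n = 0 <;> simp [jumpRate, hn, hD]
  rw [e] at h1
  simp only [h.transProb_zero]
  exact h1

theorem tendsto_transProb_zero (h : IsBMAP C D P N J) (hD : D 0 = 0) (n : ℕ) (i j : Fin m) :
    Tendsto (fun t : ℝ≥0 => transProb P N J t n i j) (𝓝 0) (𝓝 (transProb P N J 0 n i j)) := by
  have h1 : Tendsto (fun t : ℝ≥0 => transProb P N J t n i j) (𝓝[>] 0)
      (𝓝 (transProb P N J 0 n i j)) := by
    have h2 : Tendsto (fun t : ℝ≥0 => (t : ℝ)) (𝓝[>] 0) (𝓝 0) :=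
      (NNReal.continuous_coe.tendsto' 0 0 rfl).mono_left nhdsWithin_le_nhds
    have h3 := (h.tendsto_transProb_sub_div hD n i j).mul h2
    rw [mul_zero] at h3
    have h4 := h3.add_const (transProb P N J 0 n i j)
    rw [zero_add] at h4
    refine h4.congr' ?_
    filter_upwards [self_mem_nhdsWithin] with t ht
    have : (t : ℝ) ≠ 0 := by exact_mod_cast (ne_of_gt ht)
    field_simp
    ring
  have h2 : (𝓝 (0 : ℝ≥0)) = 𝓝[≠] 0 ⊔ pure 0 := (nhdsNE_sup_pure 0).symm
  have h3 : (𝓝[≠] (0 : ℝ≥0)) = 𝓝[>] 0 := by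
    congr 1
    ext x
    simp [pos_iff_ne_zero]
  rw [h2, h3]
  refine h1.sup ?_
  exact tendsto_pure_nhds _ _

theorem transProb_add_sub (h : IsBMAP C D P N J) (s t : ℝ≥0) (n : ℕ) (i j : Fin m) :
    transProb P N J (s + t) n i j - transProb P N J s n i j =
      ∑ k ∈ Finset.range (n + 1), ∑ a, transProb P N J s k i a *
        (transProb P N J t (n - k) a j - transProb P N J 0 (n - k) a j) := by
  have h1 := h.transProb_add s t n i j
  have h2 := h.transProb_add s 0 n i j
  rw [add_zero] at h2
  rw [h1, h2, ← Finset.sum_sub_distrib]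
  refine Finset.sum_congr rfl fun k _ => ?_
  rw [← Finset.sum_sub_distrib]
  exact Finset.sum_congr rfl fun a _ => by ring

theorem continuous_transProb (h : IsBMAP C D P N J) (hD : D 0 = 0) (n : ℕ) (i j : Fin m) :
    Continuous fun t : ℝ≥0 => transProb P N J t n i j := by
  have := h.prob
  let osc : ℝ≥0 → ℝ := fun t => ∑ k ∈ Finset.range (n + 1), ∑ a,
    |transProb P N J t (n - k) a j - transProb P N J 0 (n - k) a j|
  have hosc : Tendsto osc (𝓝 0) (𝓝 0) := by
    have h1 : Tendsto osc (𝓝 0) (𝓝 (∑ k ∈ Finset.range (n + 1), ∑ a : Fin m,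
        |transProb P N J 0 (n - k) a j - transProb P N J 0 (n - k) a j|)) :=
      tendsto_finsetSum _ fun k _ => tendsto_finsetSum _ fun a _ =>
        ((h.tendsto_transProb_zero hD (n - k) a j).sub_const _).abs
    simpa using h1
  have hadd : ∀ s t, |transProb P N J (s + t) n i j - transProb P N J s n i j| ≤ osc t := by
    intro s t
    rw [h.transProb_add_sub]
    refine (Finset.abs_sum_le_sum_abs _ _).trans (Finset.sum_le_sum fun k _ => ?_)
    refine (Finset.abs_sum_le_sum_abs _ _).trans (Finset.sum_le_sum fun a _ => ?_)
    rw [abs_mul, abs_of_nonneg (transProb_nonneg _ _ _ _)]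
    exact mul_le_of_le_one_left (abs_nonneg _) measureReal_le_one
  have hdist : ∀ s t, dist (transProb P N J t n i j) (transProb P N J s n i j) ≤
      osc (nndist t s) := by
    intro s t
    rw [Real.dist_eq, NNReal.nndist_eq]
    rcases le_total s t with hst | hst
    · have := hadd s (t - s)
      rw [add_tsub_cancel_of_le hst] at this
      rwa [tsub_eq_zero_of_le hst, max_eq_left zero_le]
    · have := hadd t (s - t)
      rw [add_tsub_cancel_of_le hst] at this
      rwa [tsub_eq_zero_of_le hst, max_eq_right zero_le, abs_sub_comm]
  rw [continuous_iff_continuousAt]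
  intro s
  rw [ContinuousAt, tendsto_iff_dist_tendsto_zero]
  refine squeeze_zero (fun _ => dist_nonneg) (hdist s) (hosc.comp ?_)
  exact (continuous_id.nndist continuous_const).tendsto' s 0 (nndist_self s)

/-- The Kolmogorov forward equation, for the right derivative. -/
theorem hasDerivWithinAt_transProb (h : IsBMAP C D P N J) (hD : D 0 = 0) (n : ℕ) (i j : Fin m)
    {s : ℝ} (hs : 0 ≤ s) :
    HasDerivWithinAt (fun x : ℝ => transProb P N J x.toNNReal n i j)
      (∑ k ∈ Finset.range (n + 1), ∑ a, transProb P N J s.toNNReal k i a *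
        jumpRate C D (n - k) a j) (Ici s) s := by
  rw [← hasDerivWithinAt_Ioi_iff_Ici, hasDerivWithinAt_iff_tendsto_slope' (by simp)]
  have hlim : Tendsto (fun x : ℝ => (x - s).toNNReal) (𝓝[>] s) (𝓝[>] 0) := by
    refine tendsto_nhdsWithin_iff.2 ⟨?_, ?_⟩
    · have : Continuous fun x : ℝ => (x - s).toNNReal := by fun_prop
      exact (this.tendsto' s 0 (by simp)).mono_left nhdsWithin_le_nhds
    · filter_upwards [self_mem_nhdsWithin] with x hx
      simpa using hx
  have h1 : Tendsto (fun x : ℝ => ∑ k ∈ Finset.range (n + 1), ∑ a,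
      transProb P N J s.toNNReal k i a * ((transProb P N J (x - s).toNNReal (n - k) a j -
        transProb P N J 0 (n - k) a j) / ((x - s).toNNReal : ℝ))) (𝓝[>] s)
      (𝓝 (∑ k ∈ Finset.range (n + 1), ∑ a, transProb P N J s.toNNReal k i a *
        jumpRate C D (n - k) a j)) :=
    tendsto_finsetSum _ fun k _ => tendsto_finsetSum _ fun a _ =>
      ((h.tendsto_transProb_sub_div hD (n - k) a j).comp hlim).const_mul _
  refine h1.congr' ?_
  filter_upwards [self_mem_nhdsWithin] with x hx
  have hx' : s < x := hx
  have e : x.toNNReal = s.toNNReal + (x - s).toNNReal := by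
    rw [← Real.toNNReal_add hs (by linarith)]
    congr 1
    ring
  rw [slope_def_field, e, h.transProb_add_sub, Finset.sum_div, Real.coe_toNNReal _ (by linarith)]
  refine Finset.sum_congr rfl fun k _ => ?_
  rw [Finset.sum_div]
  exact Finset.sum_congr rfl fun a _ => by rw [mul_div_assoc]

/-- Drift criterion for the process killed above the level `K`. As `V` is nonnegative, killing only
decreases the drift, so only finite sums occur and no mass at infinity has to be controlled. -/
theorem sum_transProb_mul_le (h : IsBMAP C D P N J) (hD : D 0 = 0) {V : ℕ → Fin m → ℝ} {c b : ℝ}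
    (hb : 0 ≤ b) {K : ℕ}
    (hV : ∀ k a, k ≤ K → ∑ l ∈ Finset.range (K + 1 - k), ∑ j, jumpRate C D l a j * V (k + l) j ≤
      c * V k a + b) (i : Fin m) (t : ℝ≥0) :
    ∑ n ∈ Finset.range (K + 1), ∑ j, transProb P N J t n i j * V n j ≤
      gronwallBound (V 0 i) c b t := by
  let f : ℝ → ℝ := fun x => ∑ n ∈ Finset.range (K + 1), ∑ j,
    transProb P N J x.toNNReal n i j * V n j
  let f' : ℝ → ℝ := fun x => ∑ n ∈ Finset.range (K + 1), ∑ j,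
    (∑ k ∈ Finset.range (n + 1), ∑ a, transProb P N J x.toNNReal k i a *
        jumpRate C D (n - k) a j) * V n j
  have hcont : ContinuousOn f (Icc 0 t) := by
    refine Continuous.continuousOn ?_
    refine continuous_finsetSum _ fun n _ => continuous_finsetSum _ fun j _ => ?_
    exact ((h.continuous_transProb hD n i j).comp continuous_real_toNNReal).mul continuous_const
  have hderiv : ∀ x ∈ Ico (0 : ℝ) t, HasDerivWithinAt f (f' x) (Ici x) x := by
    intro x hx
    exact HasDerivWithinAt.fun_sum fun n _ => HasDerivWithinAt.fun_sum fun j _ =>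
      (h.hasDerivWithinAt_transProb hD n i j hx.1).mul_const _
  have h0 : f 0 ≤ V 0 i := by
    simp only [f, Real.toNNReal_zero, h.transProb_zero]
    rw [Finset.sum_eq_single 0]
    · simp
    · intro n _ hn
      simp [hn]
    · simp
  have hf' : ∀ x, f' x = ∑ k ∈ Finset.range (K + 1), ∑ a, transProb P N J x.toNNReal k i a *
      ∑ l ∈ Finset.range (K + 1 - k), ∑ j, jumpRate C D l a j * V (k + l) j := by
    intro x
    have e1 : f' x = ∑ n ∈ Finset.range (K + 1), ∑ k ∈ Finset.range (n + 1), ∑ a,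
        ∑ j, transProb P N J x.toNNReal k i a * (jumpRate C D (n - k) a j * V n j) := by
      refine Finset.sum_congr rfl fun n _ => ?_
      simp only [Finset.sum_mul, mul_assoc]
      rw [Finset.sum_comm]
      exact Finset.sum_congr rfl fun k _ => Finset.sum_comm
    rw [e1, Finset.sum_comm' (t' := Finset.range (K + 1)) (s' := fun k => Finset.Ico k (K + 1))]
    · refine Finset.sum_congr rfl fun k _ => ?_
      rw [Finset.sum_Ico_eq_sum_range, Finset.sum_comm]
      refine Finset.sum_congr rfl fun a _ => ?_
      simp only [Finset.mul_sum, add_tsub_cancel_left]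
    · intro n k
      simp only [Finset.mem_range, Finset.mem_Ico]
      omega
  have hbound : ∀ x ∈ Ico (0 : ℝ) t, f' x ≤ c * f x + b := by
    intro x _
    rw [hf']
    calc _ ≤ ∑ k ∈ Finset.range (K + 1), ∑ a, transProb P N J x.toNNReal k i a *
          (c * V k a + b) := by
          refine Finset.sum_le_sum fun k hk => Finset.sum_le_sum fun a _ => ?_
          refine mul_le_mul_of_nonneg_left (hV k a ?_) (transProb_nonneg _ _ _ _)
          simpa [Nat.lt_succ_iff] using hk
      _ = c * f x + b * ∑ k ∈ Finset.range (K + 1), ∑ a, transProb P N J x.toNNReal k i a := by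
          simp only [f, mul_add, Finset.sum_add_distrib, Finset.mul_sum]
          congr 1 <;> exact Finset.sum_congr rfl fun k _ => Finset.sum_congr rfl fun a _ => by ring
      _ ≤ _ := by
          have := h.sum_transProb_le_one x.toNNReal (K + 1) i
          nlinarith
  have h1 := le_gronwallBound_of_liminf_deriv_right_le hcont (f' := f')
    (fun x hx r hr => by simpa [slope, smul_eq_mul] using (hderiv x hx).liminf_right_slope_le hr)
    h0 hbound t ⟨t.2, le_rfl⟩
  simpa [f] using h1

/-- Drift criterion: a nonnegative function whose drift is at most `c V + b` has an expectation
that grows no faster than the corresponding linear differential equation. -/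
theorem lintegral_le_of_drift (h : IsBMAP C D P N J) (hD : D 0 = 0) {V : ℕ → Fin m → ℝ}
    {c b : ℝ} (hV0 : ∀ n j, 0 ≤ V n j) (hb : 0 ≤ b)
    (hV : ∀ k a L, ∑ l ∈ Finset.range (L + 1), ∑ j, jumpRate C D l a j * V (k + l) j ≤
      c * V k a + b) (i : Fin m) (t : ℝ≥0) :
    ∫⁻ ω, ENNReal.ofReal (V (N t ω) (J t ω)) ∂(P i) ≤
      ENNReal.ofReal (gronwallBound (V 0 i) c b t) := by
  have := h.prob i
  have e : ∫⁻ ω, ENNReal.ofReal (V (N t ω) (J t ω)) ∂(P i) =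
      ∑' n, ENNReal.ofReal (∑ j, transProb P N J t n i j * V n j) := by
    rw [← lintegral_map (f := fun z : ℕ × Fin m => ENNReal.ofReal (V z.1 z.2))
      (measurable_of_countable _) (h.measurable_pair t), lintegral_countable', ENNReal.tsum_prod']
    refine tsum_congr fun n => ?_
    rw [tsum_fintype, ENNReal.ofReal_sum_of_nonneg
      fun j _ => mul_nonneg (transProb_nonneg _ _ _ _) (hV0 n j)]
    refine Finset.sum_congr rfl fun j _ => ?_
    rw [Measure.map_apply (h.measurable_pair t) (measurableSet_singleton _),
      ENNReal.ofReal_mul (transProb_nonneg _ _ _ _), transProb, ofReal_measureReal, mul_comm]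
    congr 2
    ext ω
    simp
  rw [e]
  refine ENNReal.tsum_le_of_sum_range_le fun K => ?_
  rcases K with _ | K
  · simp
  · rw [← ENNReal.ofReal_sum_of_nonneg fun n _ => Finset.sum_nonneg fun j _ =>
      mul_nonneg (transProb_nonneg _ _ _ _) (hV0 n j)]
    refine ENNReal.ofReal_le_ofReal (h.sum_transProb_mul_le hD hb (fun k a hk => ?_) i t)
    rw [show K + 1 - k = (K - k) + 1 by omega]
    exact hV k a (K - k)

end IsBMAP

/-! ### Drift of product test functions -/

theorem IsBMAPParam.summable_nat_mul {m : ℕ} {C : Matrix (Fin m) (Fin m) ℝ}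
    {D : ℕ → Matrix (Fin m) (Fin m) ℝ} (hD : IsBMAPParam C D) (hb : BatchTailBound D)
    (i j : Fin m) : Summable fun k : ℕ => (k : ℝ) * D k i j := by
  obtain ⟨δ, hδ, K, -, hK⟩ := hb.exists_rate_le hD
  simpa using hD.summable_mul hK 1 hδ i j

theorem smul_tsum_apply {m : ℕ} {D : ℕ → Matrix (Fin m) (Fin m) ℝ}
    (h1 : ∀ i j, Summable fun k : ℕ => (k : ℝ) * D k i j) (i j : Fin m) :
    (∑' k : ℕ, (k : ℝ) • D k) i j = ∑' k : ℕ, (k : ℝ) * D k i j :=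
  matrix_tsum_apply (f := fun k : ℕ => (k : ℝ) • D k) (matrix_summable_iff.2 h1) i j

/-- The drift of `V(n, j) = u(n) (1 + τ w j)`, where `w` is the corrector and `u` grows over a jump
of size `l` by at most the factor `1 + τ l + τ² ψ(l)`, up to an additive `β(l)`. The corrector
cancels the phase-dependent part of the first order term, which leaves the rate `τ λ + O(τ²)`. -/
theorem IsBMAPParam.drift_le {m : ℕ} {C : Matrix (Fin m) (Fin m) ℝ}
    {D : ℕ → Matrix (Fin m) (Fin m) ℝ} (hD : IsBMAPParam C D)
    (h1 : ∀ i j, Summable fun k : ℕ => (k : ℝ) * D k i j)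
    {lam : ℝ} (hlam : 0 ≤ lam) {w : Fin m → ℝ}
    (hw : ∀ i, ((C + ∑' k, D k) *ᵥ w) i = lam - ((∑' k : ℕ, (k : ℝ) • D k) *ᵥ 1) i)
    {τ : ℝ} (hτ : |τ| ≤ 1) (hτw : ∀ i, 0 ≤ τ * w i) {u ψ β : ℕ → ℝ} (hu : ∀ n, 0 ≤ u n)
    (hψ : ∀ l, 0 ≤ ψ l) (hβ : ∀ l, 0 ≤ β l) (hfac : ∀ l : ℕ, 0 ≤ 1 + τ * l + τ ^ 2 * ψ l)
    (hstep : ∀ k l : ℕ, u (k + l) ≤ u k * (1 + τ * l + τ ^ 2 * ψ l) + β l)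
    (hψs : ∀ i j, Summable fun l => ψ l * D l i j) (hβs : ∀ i j, Summable fun l => β l * D l i j)
    {W S₁ Sψ Sβ : ℝ} (hW : ∀ i, |w i| ≤ W)
    (hS₁ : ∀ a, ∑ j, ∑' l : ℕ, (l : ℝ) * D l a j ≤ S₁)
    (hSψ : ∀ a, ∑ j, ∑' l, ψ l * D l a j ≤ Sψ) (hSβ : ∀ a, ∑ j, ∑' l, β l * D l a j ≤ Sβ)
    (k : ℕ) (a : Fin m) (L : ℕ) :
    ∑ l ∈ Finset.range (L + 1), ∑ j, jumpRate C D l a j * (u (k + l) * (1 + τ * w j)) ≤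
      (τ * lam + τ ^ 2 * (W * S₁ + (1 + W) * Sψ + lam * W)) * (u k * (1 + τ * w a)) +
        (1 + W) * Sβ := by
  have hv0 : ∀ j, 0 ≤ 1 + τ * w j := fun j => by linarith [hτw j]
  have hW0 : 0 ≤ W := (abs_nonneg _).trans (hW a)
  have hvW : ∀ j, 1 + τ * w j ≤ 1 + W := fun j => by
    have : τ * w j ≤ |τ| * |w j| := by rw [← abs_mul]; exact le_abs_self _
    have : |τ| * |w j| ≤ 1 * W := mul_le_mul hτ (hW j) (abs_nonneg _) zero_le_one
    linarith
  have hD0 := matrix_summable_iff.1 hD.D_summable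
  set E0 : Fin m → ℝ := fun j => ∑' l, D l a j
  set E1 : Fin m → ℝ := fun j => ∑' l : ℕ, (l : ℝ) * D l a j
  set Eψ : Fin m → ℝ := fun j => ∑' l, ψ l * D l a j
  set Eβ : Fin m → ℝ := fun j => ∑' l, β l * D l a j
  have hE1 : ∀ j, 0 ≤ E1 j := fun j =>
    tsum_nonneg fun l => mul_nonneg l.cast_nonneg (hD.D_nonneg _ _ _)
  have hEψ : ∀ j, 0 ≤ Eψ j := fun j =>
    tsum_nonneg fun l => mul_nonneg (hψ l) (hD.D_nonneg _ _ _)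
  have hEβ : ∀ j, 0 ≤ Eβ j := fun j =>
    tsum_nonneg fun l => mul_nonneg (hβ l) (hD.D_nonneg _ _ _)
  -- Separate the diagonal part and bound the jumps by the full series.
  have hA : ∑ l ∈ Finset.range (L + 1), ∑ j, jumpRate C D l a j * (u (k + l) * (1 + τ * w j)) ≤
      u k * ∑ j, C a j * (1 + τ * w j) +
        ∑ j, (1 + τ * w j) * (u k * (E0 j + τ * E1 j + τ ^ 2 * Eψ j) + Eβ j) := by
    rw [Finset.sum_comm, Finset.mul_sum, ← Finset.sum_add_distrib]
    refine Finset.sum_le_sum fun j _ => ?_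
    have e1 : ∑ l ∈ Finset.range (L + 1), jumpRate C D l a j * (u (k + l) * (1 + τ * w j)) =
        u k * (C a j * (1 + τ * w j)) +
          (1 + τ * w j) * ∑ l ∈ Finset.range (L + 1), D l a j * u (k + l) := by
      simp only [jumpRate, add_mul, Finset.sum_add_distrib, ite_mul, zero_mul]
      rw [Finset.sum_ite_eq' (Finset.range (L + 1)) 0]
      simp only [Finset.mem_range, Nat.succ_pos, if_true, add_zero, Finset.mul_sum]
      rw [add_comm]
      simp only [Finset.sum_add_distrib, one_mul, mul_add]
      have e3 : ∀ c : ℝ, ∀ x : ℕ, D x a j * (u (k + x) * c) = c * (D x a j * u (k + x)) :=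
        fun c x => by ring
      simp only [mul_one, e3]
      ring
    rw [e1]
    refine add_le_add le_rfl (mul_le_mul_of_nonneg_left ?_ (hv0 j))
    have hsum : HasSum (fun l : ℕ => u k * (D l a j + τ * ((l : ℝ) * D l a j) +
        τ ^ 2 * (ψ l * D l a j)) + β l * D l a j)
        (u k * (E0 j + τ * E1 j + τ ^ 2 * Eψ j) + Eβ j) :=
      ((((hD0 a j).hasSum.add ((h1 a j).hasSum.mul_left τ)).add
        ((hψs a j).hasSum.mul_left (τ ^ 2))).mul_left (u k)).add (hβs a j).hasSum
    have hterm : ∀ l : ℕ, u k * (D l a j + τ * ((l : ℝ) * D l a j) +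
        τ ^ 2 * (ψ l * D l a j)) + β l * D l a j =
        D l a j * (u k * (1 + τ * l + τ ^ 2 * ψ l) + β l) := fun l => by ring
    refine (Finset.sum_le_sum fun l _ => ?_).trans (sum_le_hasSum (Finset.range (L + 1)) ?_ hsum)
    · rw [hterm]
      exact mul_le_mul_of_nonneg_left (hstep k l) (hD.D_nonneg _ _ _)
    · intro l _
      rw [hterm]
      exact mul_nonneg (hD.D_nonneg _ _ _)
        (add_nonneg (mul_nonneg (hu k) (hfac l)) (hβ l))
  have hQ1 : ∑ j, (C a j + E0 j) = 0 := by
    have := congrFun hD.row_sum a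
    simpa [Matrix.mulVec, dotProduct, matrix_tsum_apply hD.D_summable] using this
  have hQw : ∑ j, (C a j + E0 j) * w j = lam - ∑ j, E1 j := by
    have := hw a
    simpa [Matrix.mulVec, dotProduct, matrix_tsum_apply hD.D_summable, smul_tsum_apply h1] using this
  have hB : u k * ∑ j, C a j * (1 + τ * w j) +
        ∑ j, (1 + τ * w j) * (u k * (E0 j + τ * E1 j + τ ^ 2 * Eψ j) + Eβ j) =
      u k * (τ * lam + τ ^ 2 * (∑ j, w j * E1 j + ∑ j, (1 + τ * w j) * Eψ j)) +
        ∑ j, (1 + τ * w j) * Eβ j := by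
    have e : u k * ∑ j, C a j * (1 + τ * w j) +
        ∑ j, (1 + τ * w j) * (u k * (E0 j + τ * E1 j + τ ^ 2 * Eψ j) + Eβ j) =
        u k * (∑ j, (C a j + E0 j) + τ * (∑ j, (C a j + E0 j) * w j + ∑ j, E1 j) +
          τ ^ 2 * (∑ j, w j * E1 j + ∑ j, (1 + τ * w j) * Eψ j)) +
          ∑ j, (1 + τ * w j) * Eβ j := by
      simp only [Finset.mul_sum, ← Finset.sum_add_distrib]
      exact Finset.sum_congr rfl fun j _ => by ring
    rw [e, hQ1, hQw]
    ring
  have hC1 : ∑ j, w j * E1 j ≤ W * S₁ := by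
    calc ∑ j, w j * E1 j ≤ ∑ j, W * E1 j :=
          Finset.sum_le_sum fun j _ =>
            mul_le_mul_of_nonneg_right ((le_abs_self _).trans (hW j)) (hE1 j)
      _ ≤ W * S₁ := by
          rw [← Finset.mul_sum]
          exact mul_le_mul_of_nonneg_left (hS₁ a) hW0
  have hCv : ∀ {E : Fin m → ℝ} {S : ℝ}, (∀ j, 0 ≤ E j) → ∑ j, E j ≤ S →
      ∑ j, (1 + τ * w j) * E j ≤ (1 + W) * S := by
    intro E S hE hS
    calc ∑ j, (1 + τ * w j) * E j ≤ ∑ j, (1 + W) * E j :=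
          Finset.sum_le_sum fun j _ => mul_le_mul_of_nonneg_right (hvW j) (hE j)
      _ ≤ (1 + W) * S := by
          rw [← Finset.mul_sum]
          exact mul_le_mul_of_nonneg_left hS (by linarith)
  have hSψ0 : 0 ≤ Sψ := (Finset.sum_nonneg fun j _ => hEψ j).trans (hSψ a)
  have hS10 : 0 ≤ S₁ := (Finset.sum_nonneg fun j _ => hE1 j).trans (hS₁ a)
  refine hA.trans (hB.le.trans (add_le_add ?_ (hCv hEβ (hSβ a))))
  rw [mul_left_comm]
  refine mul_le_mul_of_nonneg_left ?_ (hu k)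
  set K₁ := W * S₁ + (1 + W) * Sψ with hK₁
  have hK0 : 0 ≤ K₁ := by positivity
  have h3 : τ * lam + τ ^ 2 * (∑ j, w j * E1 j + ∑ j, (1 + τ * w j) * Eψ j) ≤
      τ * lam + τ ^ 2 * K₁ := by
    have := hCv hEψ (hSψ a)
    gcongr
    linarith
  have h4 : (τ * lam + τ ^ 2 * (K₁ + lam * W)) * (1 + τ * w a) - (τ * lam + τ ^ 2 * K₁) =
      τ ^ 2 * lam * (W + w a) + τ ^ 2 * (K₁ + lam * W) * (τ * w a) := by ring
  have h5 : 0 ≤ τ ^ 2 * lam * (W + w a) := by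
    have := neg_le_of_abs_le (hW a)
    exact mul_nonneg (by positivity) (by linarith)
  have h6 : 0 ≤ τ ^ 2 * (K₁ + lam * W) * (τ * w a) := mul_nonneg (by positivity) (hτw a)
  linarith

/-! ### A convex test function -/

/-- The function `y ↦ e^{θ y} / θ` for `y ≤ 0`, continued with slope one. It dominates `y⁺`, grows
over a jump by at most the exponential factor, and is Lipschitz, so that a single huge jump costs no
more than its size. -/
noncomputable def linExp (θ y : ℝ) : ℝ := if y ≤ 0 then Real.exp (θ * y) / θ else y + 1 / θ

theorem linExp_nonneg {θ : ℝ} (hθ : 0 < θ) (y : ℝ) : 0 ≤ linExp θ y := by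
  rw [linExp]
  split_ifs with h
  · positivity
  · rw [not_le] at h
    positivity

theorem le_linExp {θ : ℝ} (hθ : 0 < θ) (y : ℝ) : y ≤ linExp θ y := by
  rw [linExp]
  split_ifs with h
  · exact h.trans (by positivity)
  · linarith [one_div_pos.2 hθ]

theorem linExp_add_le_exp_mul {θ : ℝ} (hθ : 0 < θ) (y : ℝ) {l : ℝ} (hl : 0 ≤ l) :
    linExp θ (y + l) ≤ Real.exp (θ * l) * linExp θ y := by
  have key : ∀ z, z + 1 / θ ≤ Real.exp (θ * z) / θ := fun z => by
    rw [le_div_iff₀ hθ, add_mul, one_div_mul_cancel hθ.ne']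
    linarith [Real.add_one_le_exp (θ * z)]
  simp only [linExp]
  split_ifs with h1 h2 h2
  · rw [← mul_div_assoc, ← Real.exp_add]
    ring_nf
    exact le_rfl
  · linarith
  · rw [← mul_div_assoc, ← Real.exp_add]
    refine (key _).trans (le_of_eq ?_)
    ring_nf
  · rw [not_le] at h2
    have h3 := Real.add_one_le_exp (θ * l)
    have h4 : 0 < y + 1 / θ := by positivity
    have h5 : (θ * l + 1) * (y + 1 / θ) = θ * l * y + l + (y + 1 / θ) := by
      field_simp
    have h6 : 0 ≤ θ * l * y := by positivity
    nlinarith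

theorem linExp_add_le_add {θ : ℝ} (hθ : 0 < θ) (y : ℝ) {l : ℝ} (hl : 0 ≤ l) :
    linExp θ (y + l) ≤ linExp θ y + l := by
  simp only [linExp]
  split_ifs with h1 h2 h2
  · rw [← sub_le_iff_le_add', ← sub_div, div_le_iff₀ hθ]
    have e : Real.exp (θ * y) = Real.exp (θ * (y + l)) * Real.exp (-(θ * l)) := by
      rw [← Real.exp_add]; ring_nf
    have h3 : Real.exp (θ * (y + l)) ≤ 1 := Real.exp_le_one_iff.2 (by nlinarith)
    have h4 := Real.add_one_le_exp (-(θ * l))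
    have h5 : Real.exp (-(θ * l)) ≤ 1 := Real.exp_le_one_iff.2 (by nlinarith)
    have h6 := Real.exp_pos (θ * (y + l))
    rw [e]
    nlinarith
  · linarith
  · have : 1 / θ + y ≤ Real.exp (θ * y) / θ := by
      rw [le_div_iff₀ hθ, add_mul, one_div_mul_cancel hθ.ne']
      linarith [Real.add_one_le_exp (θ * y)]
    linarith
  · linarith

theorem Real.exp_le_one_add_add_sq {z : ℝ} (hz : 0 ≤ z) :
    Real.exp z ≤ 1 + z + z ^ 2 * Real.exp z := by
  have h1 := Real.add_one_le_exp (-z)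
  have h2 : Real.exp z * Real.exp (-z) = 1 := by rw [← Real.exp_add]; simp
  have h3 := Real.exp_pos z
  have h4 : Real.exp z - 1 ≤ z * Real.exp z := by nlinarith
  nlinarith

theorem Real.exp_neg_le_one_sub_add_sq {z : ℝ} (hz : 0 ≤ z) :
    Real.exp (-z) ≤ 1 - z + z ^ 2 := by
  have h1 := Real.add_one_le_exp z
  have h2 : Real.exp z * Real.exp (-z) = 1 := by rw [← Real.exp_add]; simp
  have h3 := Real.exp_pos (-z)
  have h4 : Real.exp (-z) ≤ 1 / (z + 1) := by
    rw [le_div_iff₀ (by linarith)]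
    nlinarith
  refine h4.trans ?_
  rw [div_le_iff₀ (by linarith)]
  nlinarith [pow_nonneg hz 3]

/-! ### Moment bounds for the number of arrivals -/

/-- The corrector is unique up to constants, so both signs are available. -/
theorem IsBMAPParam.exists_signed_corrector {m : ℕ} {C : Matrix (Fin m) (Fin m) ℝ}
    {D : ℕ → Matrix (Fin m) (Fin m) ℝ} (hD : IsBMAPParam C D) {p : Fin m → ℝ}
    (hp : IsStationaryVector (C + ∑' k, D k) p) {ε : ℝ} (hε : |ε| = 1) :
    ∃ w : Fin m → ℝ, (∀ i, 0 ≤ ε * w i) ∧ ∃ W, 0 ≤ W ∧ (∀ i, |w i| ≤ W) ∧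
      ∀ i, ((C + ∑' k, D k) *ᵥ w) i =
        arrivalRate p D - ((∑' k : ℕ, (k : ℝ) • D k) *ᵥ 1) i := by
  obtain ⟨w, hw⟩ := hD.exists_corrector hp
  have hsum : ∀ i, |w i| ≤ ∑ j, |w j| := fun i =>
    Finset.single_le_sum (f := fun j => |w j|) (fun _ _ => abs_nonneg _) (Finset.mem_univ i)
  set W := ∑ j, |w j| with hWdef
  have hW0 : 0 ≤ W := Finset.sum_nonneg fun _ _ => abs_nonneg _
  have hε2 : ε * ε = 1 := by
    have := sq_abs ε
    rw [hε] at this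
    linarith
  refine ⟨w + (ε * W) • 1, fun i => ?_, 2 * W, by linarith, fun i => ?_, fun i => ?_⟩
  · have h1 : -(W) ≤ ε * w i := by
      have h2 : |ε * w i| ≤ W := by rw [abs_mul, hε, one_mul]; exact hsum i
      exact (abs_le.1 h2).1
    simp only [Pi.add_apply, Pi.smul_apply, Pi.one_apply, smul_eq_mul, mul_one]
    nlinarith
  · simp only [Pi.add_apply, Pi.smul_apply, Pi.one_apply, smul_eq_mul, mul_one]
    refine (abs_add_le _ _).trans ?_
    rw [abs_mul, hε, one_mul, abs_of_nonneg hW0]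
    linarith [hsum i]
  · rw [Matrix.mulVec_add, Matrix.mulVec_smul, hD.row_sum, smul_zero, add_zero]
    exact hw i

theorem exists_bound_of_fin {m : ℕ} (f : Fin m → ℝ) : ∃ S, 0 ≤ S ∧ ∀ a, f a ≤ S :=
  ⟨∑ j, |f j|, Finset.sum_nonneg fun _ _ => abs_nonneg _, fun a => (le_abs_self _).trans
    (Finset.single_le_sum (f := fun j => |f j|) (fun _ _ => abs_nonneg _) (Finset.mem_univ a))⟩

theorem gronwallBound_le_mul_exp {δ c b t : ℝ} (hc : 0 < c) (hb : 0 ≤ b) :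
    gronwallBound δ c b t ≤ (δ + b * t) * Real.exp (c * t) := by
  rw [gronwallBound_of_K_ne_0 hc.ne', add_mul]
  refine add_le_add le_rfl ?_
  have h1 := Real.add_one_le_exp (-(c * t))
  have h2 : Real.exp (c * t) * Real.exp (-(c * t)) = 1 := by rw [← Real.exp_add]; simp
  have h3 := Real.exp_pos (c * t)
  have h4 : Real.exp (c * t) - 1 ≤ (c * t) * Real.exp (c * t) := by nlinarith
  calc b / c * (Real.exp (c * t) - 1) ≤ b / c * ((c * t) * Real.exp (c * t)) :=
        mul_le_mul_of_nonneg_left h4 (by positivity)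
    _ = _ := by field_simp

namespace IsBMAP

variable {Ω : Type*} [MeasurableSpace Ω] {m : ℕ} {C : Matrix (Fin m) (Fin m) ℝ}
  {D : ℕ → Matrix (Fin m) (Fin m) ℝ} {P : Fin m → Measure Ω}
  {N : ℝ≥0 → Ω → ℕ} {J : ℝ≥0 → Ω → Fin m}

/-- Moderate deviations above the mean. The exponent `θ = η / √s` keeps the second order term
`θ² t` bounded for `λ t ≤ s`, and batches of size at most `s` have `θ l ≤ η √l`, which their
stretched exponential tail absorbs; larger batches only enter through the last term. -/
theorem exists_lintegral_sub_le (h : IsBMAP C D P N J) (hD : IsBMAPParam C D) {p : Fin m → ℝ}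
    (hp : IsStationaryVector (C + ∑' k, D k) p) (hlam : 0 < arrivalRate p D)
    (hb : BatchTailBound D) :
    ∃ η : ℝ, 0 < η ∧ ∃ A : ℝ, 0 ≤ A ∧ ∀ (i : Fin m) (t : ℝ≥0) (s x : ℝ), 1 ≤ s → 0 ≤ x →
      arrivalRate p D * t ≤ s →
      ∫⁻ ω, ENNReal.ofReal (N t ω - x) ∂(P i) ≤
        ENNReal.ofReal (A * Real.sqrt s *
          Real.exp (-(η * ((x - arrivalRate p D * t) / Real.sqrt s))) +
          A * t * Real.exp (-(η * Real.sqrt s))) := by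
  obtain ⟨δ, hδ, K₀, hK₀, hK⟩ := hb.exists_rate_le hD
  obtain ⟨w, hw0, W, hW0, hW, hw⟩ := hD.exists_signed_corrector hp (abs_one (α := ℝ))
  simp only [one_mul] at hw0
  set lam := arrivalRate p D with hlamdef
  -- `2 η < δ` lets the batch tail absorb `e^{2 η √l}`, and `η ≤ 1` keeps `θ = η / √s` below one.
  set η := min (δ / 4) 1 with hη
  have hη0 : 0 < η := lt_min (by positivity) one_pos
  have hη1 : η ≤ 1 := min_le_right _ _
  have hηδ : 2 * η < δ := by
    have := min_le_left (δ / 4) 1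
    linarith
  have h1 := hD.summable_nat_mul hb
  set ψ : ℕ → ℝ := fun l => (l : ℝ) ^ 2 * Real.exp (η * Real.sqrt l) with hψdef
  set φ : ℕ → ℝ := fun l => (l : ℝ) ^ 1 * Real.exp (2 * η * Real.sqrt l) with hφdef
  have hψs : ∀ i j, Summable fun l => ψ l * D l i j := hD.summable_mul hK 2 (by linarith)
  have hφs : ∀ i j, Summable fun l => φ l * D l i j := hD.summable_mul hK 1 hηδ
  obtain ⟨S₁, hS₁0, hS₁⟩ := exists_bound_of_fin fun a => ∑ j, ∑' l : ℕ, (l : ℝ) * D l a j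
  obtain ⟨Sψ, hSψ0, hSψ⟩ := exists_bound_of_fin fun a => ∑ j, ∑' l, ψ l * D l a j
  obtain ⟨Sφ, hSφ0, hSφ⟩ := exists_bound_of_fin fun a => ∑ j, ∑' l, φ l * D l a j
  set K := W * S₁ + (1 + W) * Sψ + lam * W with hKdef
  have hK0 : 0 ≤ K := by positivity
  refine ⟨η, hη0, (1 + W) * (1 / η + Sφ) * Real.exp (K / lam), by positivity, ?_⟩
  intro i t s x hs hx hts
  have hr0 : 0 < Real.sqrt s := Real.sqrt_pos.2 (by linarith)
  have hr1 : 1 ≤ Real.sqrt s := Real.one_le_sqrt.2 hs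
  have hrs : Real.sqrt s ^ 2 = s := Real.sq_sqrt (by linarith)
  set r := Real.sqrt s with hr
  set θ := η / r with hθdef
  have hθ0 : 0 < θ := by positivity
  have hθ1 : θ ≤ 1 := (div_le_one hr0).2 (hη1.trans hr1)
  set β : ℕ → ℝ := fun l => Real.exp (-(2 * η * r)) * φ l with hβdef
  have hβs : ∀ i j, Summable fun l => β l * D l i j := fun i j => by
    simpa only [hβdef, mul_assoc] using (hφs i j).mul_left (Real.exp (-(2 * η * r)))
  have hSβ : ∀ a, ∑ j, ∑' l, β l * D l a j ≤ Real.exp (-(2 * η * r)) * Sφ := fun a => by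
    simp only [hβdef, mul_assoc, tsum_mul_left, ← Finset.mul_sum]
    exact mul_le_mul_of_nonneg_left (hSφ a) (Real.exp_pos _).le
  have hstep : ∀ k l : ℕ, linExp θ ((k + l : ℕ) - x) ≤
      linExp θ (k - x) * (1 + θ * l + θ ^ 2 * ψ l) + β l := by
    intro k l
    have hl0 : (0 : ℝ) ≤ l := l.cast_nonneg
    have e : ((k + l : ℕ) : ℝ) - x = (k - x) + l := by push_cast; ring
    have hu := linExp_nonneg hθ0 (k - x)
    rw [e]
    -- Batches up to the size `s` use the exponential growth of the test function, larger ones its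
    -- Lipschitz bound together with `1 ≤ e^{2 η (√l - √s)}`.
    rcases le_or_gt (l : ℝ) s with hls | hls
    · have h2 : θ * l ≤ η * Real.sqrt l := by
        rw [hθdef, div_mul_eq_mul_div, mul_div_assoc]
        refine mul_le_mul_of_nonneg_left ?_ hη0.le
        rw [div_le_iff₀ hr0]
        calc (l : ℝ) = Real.sqrt l * Real.sqrt l := (Real.mul_self_sqrt hl0).symm
          _ ≤ _ := mul_le_mul_of_nonneg_left (Real.sqrt_le_sqrt hls) (Real.sqrt_nonneg _)
      have h3 : Real.exp (θ * l) ≤ 1 + θ * l + θ ^ 2 * ψ l := by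
        refine (Real.exp_le_one_add_add_sq (by positivity)).trans ?_
        have hψl : ψ l = (l : ℝ) ^ 2 * Real.exp (η * Real.sqrt l) := rfl
        rw [hψl, mul_pow, mul_assoc]
        gcongr
      refine (linExp_add_le_exp_mul hθ0 _ hl0).trans ?_
      rw [mul_comm]
      have : 0 ≤ β l := by positivity
      linarith [mul_le_mul_of_nonneg_left h3 hu]
    · have h2 : (l : ℝ) ≤ β l := by
        have e2 : β l = l * Real.exp (2 * η * (Real.sqrt l - r)) := by
          simp only [hβdef, hφdef, pow_one]
          rw [mul_left_comm, ← Real.exp_add]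
          ring_nf
        rw [e2]
        refine le_mul_of_one_le_right hl0 (Real.one_le_exp ?_)
        have := Real.sqrt_le_sqrt hls.le
        exact mul_nonneg (by positivity) (by linarith)
      have h3 : (1 : ℝ) ≤ 1 + θ * l + θ ^ 2 * ψ l := by
        have : 0 ≤ θ * l + θ ^ 2 * ψ l := by positivity
        linarith
      have := linExp_add_le_add hθ0 (k - x) hl0
      nlinarith
  have hdrift := hD.drift_le h1 hlam.le hw (τ := θ) (by rwa [abs_of_pos hθ0])
    (fun j => mul_nonneg hθ0.le (hw0 j)) (u := fun n : ℕ => linExp θ (n - x))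
    (fun n => linExp_nonneg hθ0 _) (fun l => by positivity) (fun l => by positivity)
    (fun l => by positivity) hstep hψs hβs hW hS₁ hSψ hSβ
  have hv : ∀ j, 1 ≤ 1 + θ * w j := fun j => by linarith [mul_nonneg hθ0.le (hw0 j)]
  have hint := h.lintegral_le_of_drift hD.D_zero
    (V := fun n j => linExp θ (n - x) * (1 + θ * w j))
    (fun n j => mul_nonneg (linExp_nonneg hθ0 _) (zero_le_one.trans (hv j)))
    (by positivity) hdrift i t
  refine (lintegral_mono fun ω => ENNReal.ofReal_le_ofReal ?_).trans
    (hint.trans (ENNReal.ofReal_le_ofReal ?_))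
  · exact (le_linExp hθ0 _).trans (le_mul_of_one_le_right (linExp_nonneg hθ0 _) (hv _))
  have ht0 : (0 : ℝ) ≤ t := t.2
  refine (gronwallBound_le_mul_exp (by positivity) (by positivity)).trans ?_
  have hV0 : linExp θ ((0 : ℕ) - x) * (1 + θ * w i) ≤
      (1 + W) * (1 / η) * r * Real.exp (-(θ * x)) := by
    have e1 : linExp θ ((0 : ℕ) - x) = (1 / η) * r * Real.exp (-(θ * x)) := by
      rw [linExp, if_pos (by simpa using hx), hθdef]
      field_simp
      simp only [Nat.cast_zero, zero_sub, mul_neg]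
      ring_nf
    rw [e1, mul_comm, mul_assoc, mul_assoc, mul_assoc]
    refine mul_le_mul_of_nonneg_right ?_ (by positivity)
    have : θ * w i ≤ 1 * W :=
      mul_le_mul hθ1 ((le_abs_self _).trans (hW i)) (hw0 i) zero_le_one
    linarith
  have hexp : Real.exp ((θ * lam + θ ^ 2 * K) * t) ≤
      Real.exp (K / lam) * Real.exp (η * (lam * t / r)) := by
    rw [← Real.exp_add]
    refine Real.exp_le_exp.2 ?_
    have e1 : θ * lam * t = η * (lam * t / r) := by rw [hθdef]; ring
    have e2 : θ ^ 2 * K * t ≤ K / lam := by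
      rw [le_div_iff₀ hlam, hθdef, div_pow, hrs]
      have h2 : η ^ 2 ≤ 1 := pow_le_one₀ hη0.le hη1
      have h3 : η ^ 2 * (lam * t) ≤ 1 * s :=
        mul_le_mul h2 hts (by positivity) zero_le_one
      calc η ^ 2 / s * K * t * lam = K * ((η ^ 2 * (lam * t)) / s) := by ring
        _ ≤ K * 1 := by
            refine mul_le_mul_of_nonneg_left ?_ hK0
            rw [div_le_one (by linarith)]
            linarith
        _ = K := mul_one K
    nlinarith
  have hexp2 : Real.exp (η * (lam * t / r)) ≤ Real.exp (η * r) := by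
    refine Real.exp_le_exp.2 (mul_le_mul_of_nonneg_left ?_ hη0.le)
    rw [div_le_iff₀ hr0, ← sq, hrs]
    exact hts
  have hfin1 : (1 + W) * (1 / η) * r * Real.exp (-(θ * x)) *
      Real.exp ((θ * lam + θ ^ 2 * K) * t) ≤ (1 + W) * (1 / η + Sφ) * Real.exp (K / lam) * r *
        Real.exp (-(η * ((x - lam * t) / r))) := by
    have e1 : Real.exp (-(η * ((x - lam * t) / r))) =
        Real.exp (-(θ * x)) * Real.exp (η * (lam * t / r)) := by
      rw [← Real.exp_add, hθdef]
      congr 1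
      ring
    rw [e1]
    calc _ ≤ (1 + W) * (1 / η) * r * Real.exp (-(θ * x)) *
          (Real.exp (K / lam) * Real.exp (η * (lam * t / r))) := by gcongr
      _ = ((1 + W) * r * Real.exp (-(θ * x)) *
          (Real.exp (K / lam) * Real.exp (η * (lam * t / r)))) * (1 / η) := by ring
      _ ≤ ((1 + W) * r * Real.exp (-(θ * x)) *
          (Real.exp (K / lam) * Real.exp (η * (lam * t / r)))) * (1 / η + Sφ) := by
          gcongr
          linarith
      _ = _ := by ring
  have hfin2 : (1 + W) * (Real.exp (-(2 * η * r)) * Sφ) * t *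
      Real.exp ((θ * lam + θ ^ 2 * K) * t) ≤
      (1 + W) * (1 / η + Sφ) * Real.exp (K / lam) * t * Real.exp (-(η * r)) := by
    have e1 : Real.exp (-(η * r)) = Real.exp (-(2 * η * r)) * Real.exp (η * r) := by
      rw [← Real.exp_add]
      congr 1
      ring
    rw [e1]
    calc _ ≤ (1 + W) * (Real.exp (-(2 * η * r)) * Sφ) * t *
          (Real.exp (K / lam) * Real.exp (η * r)) := by
          gcongr
          exact hexp.trans (by gcongr)
      _ = ((1 + W) * Real.exp (-(2 * η * r)) * t *
          (Real.exp (K / lam) * Real.exp (η * r))) * Sφ := by ring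
      _ ≤ ((1 + W) * Real.exp (-(2 * η * r)) * t *
          (Real.exp (K / lam) * Real.exp (η * r))) * (1 / η + Sφ) := by
          gcongr
          linarith [one_div_pos.2 hη0]
      _ = _ := by ring
  calc _ ≤ ((1 + W) * (1 / η) * r * Real.exp (-(θ * x)) +
        (1 + W) * (Real.exp (-(2 * η * r)) * Sφ) * t) *
        Real.exp ((θ * lam + θ ^ 2 * K) * t) := by gcongr
    _ ≤ _ := by
      rw [add_mul]
      exact add_le_add hfin1 hfin2

/-- The mean number of arrivals is at least `λ t - c`. It is extracted from the Laplace transform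
of the number of arrivals at the origin, where the drift criterion applies to a bounded function. -/
theorem exists_le_lintegral_sub (h : IsBMAP C D P N J) (hD : IsBMAPParam C D) {p : Fin m → ℝ}
    (hp : IsStationaryVector (C + ∑' k, D k) p) (hlam : 0 < arrivalRate p D)
    (hb : BatchTailBound D) :
    ∃ c : ℝ, 0 ≤ c ∧ ∀ (i : Fin m) (t : ℝ≥0) (x : ℝ), 0 ≤ x →
      ENNReal.ofReal (arrivalRate p D * t - x - c) ≤
        ∫⁻ ω, ENNReal.ofReal (N t ω - x) ∂(P i) := by
  obtain ⟨δ, hδ, K₀, hK₀, hK⟩ := hb.exists_rate_le hD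
  obtain ⟨w, hw0, W, hW0, hW, hw⟩ := hD.exists_signed_corrector hp (ε := -1) (by simp)
  set lam := arrivalRate p D with hlamdef
  have h1 := hD.summable_nat_mul hb
  have h2s : ∀ i j, Summable fun l : ℕ => (l : ℝ) ^ 2 * D l i j := fun i j => by
    simpa using hD.summable_mul hK 2 hδ i j
  obtain ⟨S₁, hS₁0, hS₁⟩ := exists_bound_of_fin fun a => ∑ j, ∑' l : ℕ, (l : ℝ) * D l a j
  obtain ⟨S₂, hS₂0, hS₂⟩ := exists_bound_of_fin fun a => ∑ j, ∑' l : ℕ, (l : ℝ) ^ 2 * D l a j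
  set K := W * S₁ + (1 + W) * S₂ + lam * W with hKdef
  refine ⟨W, hW0, fun i t x hx => ?_⟩
  have hmeas : Measurable fun ω => (N t ω : ℝ) :=
    (measurable_of_countable _).comp (h.measurable_N_apply t)
  have := h.prob i
  by_cases htop : ∫⁻ ω, ENNReal.ofReal (N t ω - x) ∂(P i) = ⊤
  · rw [htop]; exact le_top
  set I := (∫⁻ ω, ENNReal.ofReal (N t ω - x) ∂(P i)).toReal with hI
  have hII : ∫⁻ ω, ENNReal.ofReal (N t ω - x) ∂(P i) = ENNReal.ofReal I :=
    (ENNReal.ofReal_toReal htop).symm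
  have hI0 : 0 ≤ I := ENNReal.toReal_nonneg
  -- The Laplace transform at `θ` bounds the mean from below up to `O(θ)`.
  have hθ : ∀ θ : ℝ, 0 < θ → θ ≤ 1 →
      (1 - (1 + θ * W) * Real.exp ((-θ * lam + θ ^ 2 * K) * t)) / θ - x ≤ I := by
    intro θ hθ0 hθ1
    have hτw : ∀ j, 0 ≤ -θ * w j := fun j => by nlinarith [hw0 j]
    have hexp : ∀ l : ℕ, Real.exp (-(θ * l)) ≤ 1 + -θ * l + (-θ) ^ 2 * (l : ℝ) ^ 2 := fun l => by
      have := Real.exp_neg_le_one_sub_add_sq (z := θ * l) (by positivity)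
      nlinarith
    have hdrift := hD.drift_le h1 hlam.le hw (τ := -θ) (by rwa [abs_neg, abs_of_pos hθ0])
      hτw (u := fun n : ℕ => Real.exp (-(θ * n))) (ψ := fun l : ℕ => (l : ℝ) ^ 2)
      (β := fun _ => 0) (fun n => (Real.exp_pos _).le) (fun l => by positivity)
      (fun l => le_rfl) (fun l => (Real.exp_pos _).le.trans (hexp l))
      (fun k l => by
        rw [add_zero]
        have e : Real.exp (-(θ * (k + l : ℕ))) =
            Real.exp (-(θ * k)) * Real.exp (-(θ * l)) := by
          rw [← Real.exp_add]; push_cast; ring_nf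
        rw [e]
        exact mul_le_mul_of_nonneg_left (hexp l) (Real.exp_pos _).le)
      h2s (fun i j => by simp) hW hS₁ hS₂ (Sβ := 0) (fun a => by simp)
    simp only [mul_zero] at hdrift
    have hv : ∀ j, 1 ≤ 1 + -θ * w j := fun j => by linarith [hτw j]
    have hint := h.lintegral_le_of_drift hD.D_zero
      (V := fun n j => Real.exp (-(θ * n)) * (1 + -θ * w j))
      (fun n j => mul_nonneg (Real.exp_pos _).le (zero_le_one.trans (hv j))) le_rfl hdrift i t
    have hlap : ∫⁻ ω, ENNReal.ofReal (Real.exp (-(θ * N t ω))) ∂(P i) ≤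
        ENNReal.ofReal ((1 + θ * W) * Real.exp ((-θ * lam + θ ^ 2 * K) * t)) := by
      refine (lintegral_mono fun ω => ENNReal.ofReal_le_ofReal
        (le_mul_of_one_le_right (Real.exp_pos _).le (hv (J t ω)))).trans
        (hint.trans (ENNReal.ofReal_le_ofReal ?_))
      rw [gronwallBound_ε0, neg_sq]
      refine mul_le_mul_of_nonneg_right ?_ (Real.exp_pos _).le
      have := neg_le_of_abs_le (hW i)
      simp only [Nat.cast_zero, mul_zero, neg_zero, Real.exp_zero, one_mul]
      nlinarith
    have hle : ENNReal.ofReal (1 / θ - x) ≤ ENNReal.ofReal I +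
        ENNReal.ofReal (1 / θ * ((1 + θ * W) * Real.exp ((-θ * lam + θ ^ 2 * K) * t))) := by
      calc ENNReal.ofReal (1 / θ - x) = ∫⁻ _, ENNReal.ofReal (1 / θ - x) ∂(P i) := by simp
        _ ≤ ∫⁻ ω, (ENNReal.ofReal (N t ω - x) + ENNReal.ofReal (1 / θ) *
              ENNReal.ofReal (Real.exp (-(θ * N t ω)))) ∂(P i) := by
            refine lintegral_mono fun ω => ?_
            rw [← ENNReal.ofReal_mul (by positivity)]
            refine le_trans (ENNReal.ofReal_le_ofReal ?_) ENNReal.ofReal_add_le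
            have h3 := Real.add_one_le_exp (-(θ * N t ω))
            have h4 : 1 / θ * (-(θ * N t ω) + 1) ≤ 1 / θ * Real.exp (-(θ * N t ω)) :=
              mul_le_mul_of_nonneg_left h3 (by positivity)
            have e : 1 / θ * (-(θ * N t ω) + 1) = 1 / θ - N t ω := by
              field_simp
              ring
            linarith
        _ = _ := by
            rw [lintegral_add_left ((hmeas.sub_const x).ennreal_ofReal),
              lintegral_const_mul _ (by fun_prop), hII]
        _ ≤ _ := by
            rw [ENNReal.ofReal_mul (by positivity) (p := 1 / θ)]
            gcongr
    rw [← ENNReal.ofReal_add hI0 (by positivity),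
      ENNReal.ofReal_le_ofReal_iff (by positivity)] at hle
    rw [sub_div]
    rw [one_div_mul_eq_div] at hle
    linarith
  have hder : HasDerivAt (fun θ : ℝ => -((1 + θ * W) * Real.exp ((-θ * lam + θ ^ 2 * K) * t)))
      (lam * t - W) 0 := by
    have hA : HasDerivAt (fun θ : ℝ => 1 + θ * W) W 0 := by
      simpa using ((hasDerivAt_id (0 : ℝ)).mul_const W).const_add 1
    have hB : HasDerivAt (fun θ : ℝ => (-θ * lam + θ ^ 2 * K) * t) (-lam * t) 0 := by
      have h3 : HasDerivAt (fun θ : ℝ => -θ * lam) (-1 * lam) 0 :=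
        (hasDerivAt_id (0 : ℝ)).neg.mul_const lam
      have h4 : HasDerivAt (fun θ : ℝ => θ ^ 2 * K) (0 * K) 0 := by
        simpa using (hasDerivAt_pow 2 (0 : ℝ)).mul_const K
      simpa using (h3.add h4).mul_const (t : ℝ)
    have := (hA.mul hB.exp).neg
    refine this.congr_deriv ?_
    simp
    ring
  have hlim : Tendsto (fun θ : ℝ =>
      (1 - (1 + θ * W) * Real.exp ((-θ * lam + θ ^ 2 * K) * t)) / θ - x) (𝓝[>] 0)
      (𝓝 (lam * t - W - x)) := by
    have h3 := (hasDerivWithinAt_iff_tendsto_slope' (s := Ioi (0 : ℝ)) (by simp)).1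
      hder.hasDerivWithinAt
    refine (h3.sub_const x).congr fun θ => ?_
    rw [slope_def_field]
    simp
    ring
  have hfin : lam * t - W - x ≤ I := by
    refine le_of_tendsto hlim ?_
    filter_upwards [Ioc_mem_nhdsGT (zero_lt_one (α := ℝ))] with θ hθ'
    exact hθ θ hθ'.1 hθ'.2
  rw [hII]
  exact ENNReal.ofReal_le_ofReal (by linarith)

end IsBMAP

/-! ### The mean excess of the service time and the equilibrium law -/

/-- The mean excess `𝔼[(λ T - x)⁺]` of the scaled service time. -/
noncomputable def meanExcess (H : Measure ℝ≥0) (lam x : ℝ) : ℝ :=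
  ∫ t : ℝ≥0, max (lam * t - x) 0 ∂H

theorem tailProb_antitone (μ : Measure ℝ) [IsFiniteMeasure μ] : Antitone (tailProb μ) :=
  fun _ _ h => measureReal_mono (Ioi_subset_Ioi h)

theorem tailProb_map_const_mul (μ : Measure ℝ) {c : ℝ} (hc : 0 < c) (x : ℝ) :
    tailProb (μ.map fun y => c * y) x = tailProb μ (x / c) := by
  rw [tailProb, map_measureReal_apply (by fun_prop) measurableSet_Ioi, tailProb]
  congr 1
  ext y
  simp [div_lt_iff₀' hc]

theorem tailProb_map_sqrt (μ : Measure ℝ) {x : ℝ} (hx : 0 ≤ x) :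
    tailProb (μ.map Real.sqrt) x = tailProb μ (x ^ 2) := by
  rw [tailProb, map_measureReal_apply (by fun_prop) measurableSet_Ioi, tailProb]
  congr 1
  ext y
  simp [Real.lt_sqrt hx]

/-- The integrated tail is the mean excess. -/
theorem lintegral_excess_eq (H : Measure ℝ≥0) [IsFiniteMeasure H] (x : ℝ) :
    ∫⁻ t : ℝ≥0, ENNReal.ofReal (max ((t : ℝ) - x) 0) ∂H =
      ∫⁻ y in Ioi x, H {t : ℝ≥0 | y < (t : ℝ)} := by
  rw [lintegral_eq_lintegral_meas_lt (f := fun t : ℝ≥0 => max ((t : ℝ) - x) 0) H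
    (ae_of_all _ fun t => le_max_right _ _)
    (by fun_prop : Measurable fun t : ℝ≥0 => max ((t : ℝ) - x) 0).aemeasurable]
  have e1 : ∫⁻ u in Ioi (0 : ℝ), H {t : ℝ≥0 | u < max ((t : ℝ) - x) 0} =
      ∫⁻ u in Ioi (0 : ℝ), H {t : ℝ≥0 | u + x < (t : ℝ)} := by
    refine setLIntegral_congr_fun measurableSet_Ioi fun u hu => ?_
    have hu' : 0 < u := hu
    congr 1
    ext t
    simp only [mem_ofPred_eq, lt_max_iff, not_lt.2 hu'.le, or_false]
    constructor <;> intro h <;> linarith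
  rw [e1, ← lintegral_indicator measurableSet_Ioi, ← lintegral_indicator measurableSet_Ioi,
    ← lintegral_add_right_eq_self ((Ioi x).indicator fun y => H {t : ℝ≥0 | y < (t : ℝ)}) x]
  refine lintegral_congr fun u => ?_
  by_cases hu : 0 < u
  · rw [indicator_of_mem (show u ∈ Ioi 0 from hu),
      indicator_of_mem (show u + x ∈ Ioi x by simpa using hu)]
  · rw [indicator_of_notMem (show u ∉ Ioi 0 from hu),
      indicator_of_notMem (show u + x ∉ Ioi x by simpa using hu)]

theorem equilibriumLaw_Ioi (H : Measure ℝ≥0) [IsFiniteMeasure H] (hpos : 0 < meanService H)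
    {x : ℝ} (hx : 0 ≤ x) :
    equilibriumLaw H (Ioi x) = ENNReal.ofReal (meanService H)⁻¹ *
      ∫⁻ y in Ioi x, H {t : ℝ≥0 | y < (t : ℝ)} := by
  have e : Ioi x ∩ Ici 0 = Ioi x := inter_eq_left.2 fun y hy => hx.trans (le_of_lt hy)
  have e2 : ∀ y : ℝ, ENNReal.ofReal (H.real {t : ℝ≥0 | y < (t : ℝ)} / meanService H) =
      ENNReal.ofReal (meanService H)⁻¹ * H {t : ℝ≥0 | y < (t : ℝ)} := by
    intro y
    rw [div_eq_inv_mul, ENNReal.ofReal_mul (by positivity), ofReal_measureReal]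
  rw [equilibriumLaw, withDensity_apply _ measurableSet_Ioi, Measure.restrict_restrict
    measurableSet_Ioi, e]
  simp only [e2]
  rw [lintegral_const_mul]
  exact Antitone.measurable fun a b hab => measure_mono fun t (ht : b < t) => lt_of_le_of_lt hab ht

theorem integrable_excess {H : Measure ℝ≥0} [IsFiniteMeasure H]
    (hint : Integrable (fun t : ℝ≥0 => (t : ℝ)) H) (lam x : ℝ) :
    Integrable (fun t : ℝ≥0 => max (lam * t - x) 0) H :=
  ((hint.const_mul lam).sub (integrable_const x)).pos_part

theorem meanExcess_eq_mul_tailProb {H : Measure ℝ≥0} (hH : IsServiceLaw H) {lam : ℝ}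
    (hlam : 0 < lam) {x : ℝ} (hx : 0 ≤ x) :
    meanExcess H lam x = lam * meanService H * tailProb (equilibriumLaw H) (x / lam) := by
  have := hH.prob
  have hpos : 0 < meanService H := hH.mean_pos
  have e1 : meanExcess H lam x = lam * ∫ t : ℝ≥0, max ((t : ℝ) - x / lam) 0 ∂H := by
    rw [meanExcess, ← integral_const_mul]
    refine integral_congr_ae (ae_of_all _ fun t => ?_)
    change _ = lam * max ((t : ℝ) - x / lam) 0
    rw [mul_max_of_nonneg _ _ hlam.le, mul_zero, mul_sub, mul_div_cancel₀ _ hlam.ne']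
  have e2 : ∫ t : ℝ≥0, max ((t : ℝ) - x / lam) 0 ∂H =
      (∫⁻ t : ℝ≥0, ENNReal.ofReal (max ((t : ℝ) - x / lam) 0) ∂H).toReal :=
    integral_eq_lintegral_of_nonneg_ae (ae_of_all _ fun t => le_max_right _ _)
      (by fun_prop : Measurable fun t : ℝ≥0 => max ((t : ℝ) - x / lam) 0).aestronglyMeasurable
  rw [e1, e2, lintegral_excess_eq, tailProb, measureReal_def,
    equilibriumLaw_Ioi H hpos (by positivity), ENNReal.toReal_mul,
    ENNReal.toReal_ofReal (by positivity)]
  field_simp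

theorem meanExcess_nonneg (H : Measure ℝ≥0) (lam x : ℝ) : 0 ≤ meanExcess H lam x :=
  integral_nonneg fun _ => le_max_right _ _

theorem meanExcess_antitone {H : Measure ℝ≥0} (hH : IsServiceLaw H) (lam : ℝ) :
    Antitone (meanExcess H lam) := by
  have := hH.prob
  intro x y hxy
  refine integral_mono (integrable_excess hH.integrable _ _) (integrable_excess hH.integrable _ _)
    fun t => ?_
  exact max_le_max (by linarith) le_rfl

/-! ### Long tails -/

/-- For an antitone positive function one insensitive shift makes every shift insensitive. -/
theorem tendsto_shift_ratio {f : ℝ → ℝ} (hf : Antitone f) (hpos : ∀ x, 0 ≤ x → 0 < f x) {y : ℝ}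
    (hy : 0 < y) (h : Tendsto (fun x => f (x + y) / f x) atTop (𝓝 1)) {z : ℝ} (hz : 0 ≤ z) :
    Tendsto (fun x => f (x + z) / f x) atTop (𝓝 1) := by
  have hn : ∀ n : ℕ, Tendsto (fun x => f (x + n * y) / f x) atTop (𝓝 1) := by
    intro n
    induction n with
    | zero =>
      refine tendsto_const_nhds.congr' ?_
      filter_upwards [eventually_ge_atTop 0] with x hx
      simp [div_self (hpos x hx).ne']
    | succ n ih =>
      have h1 : Tendsto (fun x : ℝ => x + n * y) atTop atTop :=
        tendsto_atTop_add_const_right _ _ tendsto_id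
      have h2 := (h.comp h1).mul ih
      rw [mul_one] at h2
      refine h2.congr' ?_
      filter_upwards [eventually_ge_atTop 0] with x hx
      have h3 := (hpos (x + n * y) (by positivity)).ne'
      simp only [Function.comp]
      rw [div_mul_div_cancel₀ h3]
      push_cast
      ring_nf
  obtain ⟨n, hn1⟩ := exists_nat_ge (z / y)
  rw [div_le_iff₀ hy] at hn1
  refine tendsto_of_tendsto_of_tendsto_of_le_of_le' (hn n) tendsto_const_nhds ?_ ?_
  · filter_upwards [eventually_ge_atTop 0] with x hx
    have := hpos x hx
    gcongr
    exact hf (by linarith)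
  · filter_upwards [eventually_ge_atTop 0] with x hx
    rw [div_le_one (hpos x hx)]
    exact hf (by linarith)

theorem IsLongTailed.tendsto_shift {μ : Measure ℝ} (h : IsLongTailed μ) {z : ℝ} (hz : 0 ≤ z) :
    Tendsto (fun x => tailProb μ (x + z) / tailProb μ x) atTop (𝓝 1) := by
  have := h.prob
  obtain ⟨y, hy, hlim⟩ := h.tendsto_ratio
  exact tendsto_shift_ratio (tailProb_antitone μ) h.tail_pos hy hlim hz

theorem meanExcess_pos {H : Measure ℝ≥0} (hH : IsServiceLaw H) {lam : ℝ} (hlam : 0 < lam)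
    (hL : IsLongTailed ((equilibriumLaw H).map Real.sqrt)) {x : ℝ} (hx : 0 ≤ x) :
    0 < meanExcess H lam x := by
  rw [meanExcess_eq_mul_tailProb hH hlam hx]
  have h1 := hL.tail_pos (Real.sqrt (x / lam)) (Real.sqrt_nonneg _)
  rw [tailProb_map_sqrt _ (Real.sqrt_nonneg _), Real.sq_sqrt (by positivity)] at h1
  have := hH.mean_pos
  have h2 : 0 < meanService H := this
  positivity

/-- Square-root insensitivity of the mean excess. -/
theorem tendsto_meanExcess_sq {H : Measure ℝ≥0} (hH : IsServiceLaw H) {lam : ℝ} (hlam : 0 < lam)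
    (hL : IsLongTailed ((equilibriumLaw H).map Real.sqrt)) :
    Tendsto (fun r : ℝ => meanExcess H lam ((r + 1) ^ 2) / meanExcess H lam (r ^ 2)) atTop
      (𝓝 1) := by
  have hs : 0 < Real.sqrt lam := Real.sqrt_pos.2 hlam
  have h1 := (hL.tendsto_shift (z := 1 / Real.sqrt lam) (by positivity)).comp
    (tendsto_id.atTop_div_const hs)
  refine h1.congr' ?_
  filter_upwards [eventually_ge_atTop 0] with r hr
  have h2 : 0 < meanService H := hH.mean_pos
  rw [meanExcess_eq_mul_tailProb hH hlam (by positivity),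
    meanExcess_eq_mul_tailProb hH hlam (by positivity), mul_div_mul_left _ _ (by positivity)]
  simp only [Function.comp, id]
  rw [tailProb_map_sqrt _ (by positivity), tailProb_map_sqrt _ (by positivity), ← add_div, div_pow,
    div_pow, Real.sq_sqrt hlam.le]

/-! ### A smoothed tail that is negligible with respect to the mean excess -/

/-- A contracting linear recursion with vanishing input tends to zero. -/
theorem tendsto_zero_of_recursion {x q ε : ℕ → ℝ} {q₀ : ℝ} (hx : ∀ n, 0 ≤ x n) (hq₀ : q₀ < 1)
    (hq : Tendsto q atTop (𝓝 q₀)) (hε : Tendsto ε atTop (𝓝 0))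
    (hrec : ∀ n, x (n + 1) ≤ q n * x n + ε n) : Tendsto x atTop (𝓝 0) := by
  obtain ⟨r, hr1, hr2⟩ := exists_between (max_lt hq₀ zero_lt_one)
  have hr0 : 0 < r := (le_max_right _ _).trans_lt hr1
  have hqr := hq.eventually (gt_mem_nhds ((le_max_left _ _).trans_lt hr1))
  rw [Metric.tendsto_atTop]
  intro e he
  have hε' := hε.eventually (gt_mem_nhds (show 0 < e / 2 * (1 - r) by
    have : 0 < 1 - r := by linarith
    positivity))
  obtain ⟨n₀, hn₀⟩ := eventually_atTop.1 (hqr.and hε')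
  have hbd : ∀ n, x (n₀ + n) ≤ r ^ n * x n₀ + e / 2 := by
    intro n
    induction n with
    | zero => simp; linarith
    | succ n ih =>
      obtain ⟨h1, h2⟩ := hn₀ (n₀ + n) (by omega)
      have h3 := hrec (n₀ + n)
      have h4 := mul_le_mul_of_nonneg_right h1.le (hx (n₀ + n))
      have h5 := mul_le_mul_of_nonneg_left ih hr0.le
      rw [← add_assoc, pow_succ]
      nlinarith
  have hpow : Tendsto (fun n => r ^ n * x n₀) atTop (𝓝 0) := by
    simpa using (tendsto_pow_atTop_nhds_zero_of_lt_one hr0.le hr2).mul_const (x n₀)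
  obtain ⟨n₁, hn₁⟩ := eventually_atTop.1 (hpow.eventually (gt_mem_nhds (half_pos he)))
  refine ⟨n₀ + n₁, fun n hn => ?_⟩
  obtain ⟨k, rfl⟩ := Nat.exists_eq_add_of_le hn
  have h1 := hbd (n₁ + k)
  have h2 := hn₁ (n₁ + k) (by omega)
  rw [← add_assoc] at h1
  rw [Real.dist_eq, sub_zero, abs_of_nonneg (hx _)]
  linarith

/-- The smoothed tail `r 𝔼[min(1, e^{-η (r - √(λ T))})]`. -/
noncomputable def smoothTail (H : Measure ℝ≥0) (lam η r : ℝ) : ℝ :=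
  ∫ t : ℝ≥0, r * min 1 (Real.exp (-(η * (r - Real.sqrt (lam * t))))) ∂H

theorem integrable_smoothTail (H : Measure ℝ≥0) [IsFiniteMeasure H] (lam η r : ℝ) :
    Integrable (fun t : ℝ≥0 => r * min 1 (Real.exp (-(η * (r - Real.sqrt (lam * t)))))) H := by
  refine Integrable.const_mul (Integrable.of_bound (C := 1) ?_ (ae_of_all _ fun t => ?_)) r
  · exact (by fun_prop : Measurable fun t : ℝ≥0 =>
      min 1 (Real.exp (-(η * (r - Real.sqrt (lam * t)))))).aestronglyMeasurable
  · rw [Real.norm_of_nonneg (le_min zero_le_one (Real.exp_pos _).le)]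
    exact min_le_left _ _

theorem smoothTail_nonneg (H : Measure ℝ≥0) (lam η : ℝ) {r : ℝ} (hr : 0 ≤ r) :
    0 ≤ smoothTail H lam η r :=
  integral_nonneg fun _ => mul_nonneg hr (le_min zero_le_one (Real.exp_pos _).le)

/-- The new mass that enters in one unit step of `r` is an increment of the mean excess. -/
theorem smoothTail_add_one_le {H : Measure ℝ≥0} (hH : IsServiceLaw H) (lam : ℝ) {η : ℝ}
    (hη : 0 ≤ η) {r : ℝ} (hr : 0 ≤ r) :
    smoothTail H lam η (r + 2) ≤
      Real.exp (-η) * ((r + 2) / (r + 1)) * smoothTail H lam η (r + 1) +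
        2 * (meanExcess H lam (r ^ 2) - meanExcess H lam ((r + 1) ^ 2)) := by
  have := hH.prob
  have hE := integrable_excess hH.integrable lam
  have hS := integrable_smoothTail H lam η
  have hr1 : 0 < r + 1 := by linarith
  have hd : Integrable (fun t : ℝ≥0 =>
      2 * (max (lam * t - r ^ 2) 0 - max (lam * t - (r + 1) ^ 2) 0)) H :=
    ((hE _).sub (hE _)).const_mul _
  rw [smoothTail, smoothTail, meanExcess, meanExcess, ← integral_sub (hE _) (hE _),
    ← integral_const_mul, ← integral_const_mul, ← integral_add ((hS _).const_mul _) hd]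
  refine integral_mono (hS _) (((hS _).const_mul _).add hd) fun t => ?_
  change _ ≤ Real.exp (-η) * ((r + 2) / (r + 1)) * ((r + 1) * min 1
    (Real.exp (-(η * (r + 1 - Real.sqrt (lam * t)))))) +
      2 * (max (lam * t - r ^ 2) 0 - max (lam * t - (r + 1) ^ 2) 0)
  set S := Real.sqrt (lam * t) with hSdef
  have e : Real.exp (-η) * ((r + 2) / (r + 1)) * ((r + 1) * min 1
      (Real.exp (-(η * (r + 1 - S))))) =
      (r + 2) * (Real.exp (-η) * min 1 (Real.exp (-(η * (r + 1 - S))))) := by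
    field_simp
  rw [e]
  rcases le_or_gt S (r + 1) with h1 | h1
  · have h3 : min 1 (Real.exp (-(η * (r + 2 - S)))) ≤
        Real.exp (-η) * min 1 (Real.exp (-(η * (r + 1 - S)))) := by
      rw [min_eq_right (a := 1) (b := Real.exp (-(η * (r + 1 - S))))
        (Real.exp_le_one_iff.2 (by nlinarith)), ← Real.exp_add]
      refine (min_le_right _ _).trans (Real.exp_le_exp.2 (by linarith))
    have h4 : max (lam * t - (r + 1) ^ 2) 0 ≤ max (lam * t - r ^ 2) 0 :=
      max_le_max (by nlinarith) le_rfl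
    have := mul_le_mul_of_nonneg_left h3 (by linarith : 0 ≤ r + 2)
    linarith
  · have hl : (r + 1) ^ 2 < lam * t := (Real.lt_sqrt hr1.le).1 h1
    rw [max_eq_left (by nlinarith), max_eq_left (by linarith)]
    have h2 : 0 ≤ (r + 2) * (Real.exp (-η) * min 1 (Real.exp (-(η * (r + 1 - S))))) := by
      have : 0 ≤ min 1 (Real.exp (-(η * (r + 1 - S)))) := le_min zero_le_one (Real.exp_pos _).le
      positivity
    have h3 := mul_le_mul_of_nonneg_left (min_le_left 1 (Real.exp (-(η * (r + 2 - S)))))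
      (by linarith : 0 ≤ r + 2)
    nlinarith

theorem tendsto_smoothTail_div_nat {H : Measure ℝ≥0} (hH : IsServiceLaw H) {lam : ℝ}
    (hlam : 0 < lam) (hL : IsLongTailed ((equilibriumLaw H).map Real.sqrt)) {η : ℝ} (hη : 0 < η) :
    Tendsto (fun n : ℕ => smoothTail H lam η (n + 1) / meanExcess H lam ((n + 1) ^ 2)) atTop
      (𝓝 0) := by
  have hpos : ∀ x : ℝ, 0 < meanExcess H lam (x ^ 2) := fun x =>
    meanExcess_pos hH hlam hL (sq_nonneg x)
  have hr := (tendsto_meanExcess_sq hH hlam hL).comp tendsto_natCast_atTop_atTop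
  have hr1 := hr.comp (tendsto_add_atTop_nat 1)
  have hfrac : Tendsto (fun n : ℕ => ((n : ℝ) + 2) / (n + 1)) atTop (𝓝 1) := by
    have h1 := (tendsto_one_div_add_atTop_nhds_zero_nat (𝕜 := ℝ)).const_add 1
    rw [add_zero] at h1
    refine h1.congr fun n => ?_
    have : (n : ℝ) + 1 ≠ 0 := by positivity
    field_simp
    ring
  refine tendsto_zero_of_recursion (q₀ := Real.exp (-η))
    (q := fun n : ℕ => Real.exp (-η) * (((n : ℝ) + 2) / (n + 1)) *
      (meanExcess H lam (((n : ℝ) + 1 + 1) ^ 2) / meanExcess H lam (((n : ℝ) + 1) ^ 2))⁻¹)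
    (ε := fun n : ℕ => 2 * ((meanExcess H lam (((n : ℝ) + 1) ^ 2) / meanExcess H lam ((n : ℝ) ^ 2))⁻¹
      - 1) * (meanExcess H lam (((n : ℝ) + 1 + 1) ^ 2) / meanExcess H lam (((n : ℝ) + 1) ^ 2))⁻¹)
    (fun n => div_nonneg (smoothTail_nonneg _ _ _ (by positivity)) (hpos _).le)
    (by rw [Real.exp_lt_one_iff]; linarith) ?_ ?_ ?_
  · have h1 := (hfrac.const_mul (Real.exp (-η))).mul (hr1.inv₀ one_ne_zero)
    simp only [mul_one, inv_one] at h1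
    refine h1.congr fun n => ?_
    simp [Function.comp]
  · have h1 := (((hr.inv₀ one_ne_zero).sub_const 1).const_mul 2).mul (hr1.inv₀ one_ne_zero)
    simp only [inv_one, sub_self, mul_zero, zero_mul] at h1
    refine h1.congr fun n => ?_
    simp [Function.comp]
  · intro n
    have h1 := smoothTail_add_one_le hH lam hη.le (Nat.cast_nonneg (α := ℝ) n)
    have p0 := hpos n
    have p1 := hpos ((n : ℝ) + 1)
    have p2 := hpos ((n : ℝ) + 1 + 1)
    have e2 : (n : ℝ) + 2 = n + 1 + 1 := by ring
    push_cast
    rw [div_le_iff₀ p2, ← e2]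
    rw [← e2] at p2
    refine h1.trans (le_of_eq ?_)
    field_simp

theorem smoothTail_le_two_mul {H : Measure ℝ≥0} (hH : IsServiceLaw H) (lam : ℝ) {η : ℝ}
    (hη : 0 < η) {r r' : ℝ} (hr : 0 ≤ r) (hrr : r ≤ r') (hr2 : r' ≤ 2 * r) :
    smoothTail H lam η r' ≤ 2 * smoothTail H lam η r := by
  have := hH.prob
  rw [smoothTail, smoothTail, ← integral_const_mul]
  refine integral_mono (integrable_smoothTail H lam η _)
    ((integrable_smoothTail H lam η _).const_mul _) fun t => ?_
  change _ ≤ 2 * (r * min 1 (Real.exp (-(η * (r - Real.sqrt (lam * t))))))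
  rw [← mul_assoc]
  refine mul_le_mul hr2 ?_ (le_min zero_le_one (Real.exp_pos _).le) (by linarith)
  exact min_le_min le_rfl (Real.exp_le_exp.2 (by nlinarith))

/-- The smoothed tail is of smaller order than the mean excess: this is where the
long tail of `√T_e` enters. -/
theorem tendsto_smoothTail_div {H : Measure ℝ≥0} (hH : IsServiceLaw H) {lam : ℝ}
    (hlam : 0 < lam) (hL : IsLongTailed ((equilibriumLaw H).map Real.sqrt)) {η : ℝ} (hη : 0 < η) :
    Tendsto (fun r : ℝ => smoothTail H lam η r / meanExcess H lam (r ^ 2)) atTop (𝓝 0) := by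
  have hpos : ∀ x : ℝ, 0 < meanExcess H lam (x ^ 2) := fun x =>
    meanExcess_pos hH hlam hL (sq_nonneg x)
  have hfl : Tendsto (fun r : ℝ => ⌊r⌋₊ - 1) atTop atTop :=
    (tendsto_sub_atTop_nat 1).comp tendsto_nat_floor_atTop
  have hr := (tendsto_meanExcess_sq hH hlam hL).comp
    (tendsto_natCast_atTop_atTop.comp (tendsto_nat_floor_atTop (α := ℝ)))
  have h1 := (((tendsto_smoothTail_div_nat hH hlam hL hη).comp hfl).mul
    (hr.inv₀ one_ne_zero)).const_mul 2
  rw [inv_one, mul_one, mul_zero] at h1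
  refine squeeze_zero' ?_ ?_ h1
  · filter_upwards [eventually_ge_atTop 0] with r hr0
    exact div_nonneg (smoothTail_nonneg _ _ _ hr0) (hpos _).le
  · filter_upwards [eventually_ge_atTop 1] with r hr0
    have hn1 : 1 ≤ ⌊r⌋₊ := Nat.one_le_floor_iff _ |>.2 hr0
    have hle := Nat.floor_le (by linarith : 0 ≤ r)
    have hlt := Nat.lt_floor_add_one r
    have e : ((⌊r⌋₊ - 1 : ℕ) : ℝ) + 1 = ⌊r⌋₊ := by
      rw [Nat.cast_sub hn1]; simp
    simp only [Function.comp, e]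
    have hn1' : (1 : ℝ) ≤ ⌊r⌋₊ := by exact_mod_cast hn1
    have h2 := smoothTail_le_two_mul hH lam hη (r := ⌊r⌋₊) (r' := r) (by positivity) hle
      (by linarith)
    have h3 : meanExcess H lam (((⌊r⌋₊ : ℝ) + 1) ^ 2) ≤ meanExcess H lam (r ^ 2) :=
      meanExcess_antitone hH lam (by gcongr)
    have p0 := hpos ⌊r⌋₊
    have p1 := hpos ((⌊r⌋₊ : ℝ) + 1)
    calc _ ≤ 2 * smoothTail H lam η ⌊r⌋₊ / meanExcess H lam (((⌊r⌋₊ : ℝ) + 1) ^ 2) := by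
          have := smoothTail_nonneg H lam η (r := (⌊r⌋₊ : ℝ)) (by positivity)
          gcongr
      _ = _ := by field_simp

/-! ### The double tail as a mean excess of the number of arrivals -/

theorem seqTail_apply_eq_toReal {m : ℕ} {M : ℕ → Matrix (Fin m) (Fin m) ℝ}
    {B : ℕ → Fin m → Fin m → ℝ≥0∞} (hM : ∀ k i j, M k i j = (B k i j).toReal)
    (hB : ∀ i j, ∑' k, B k i j ≠ ⊤) (k : ℕ) (i j : Fin m) :
    seqTail M k i j = (∑' r, B (k + 1 + r) i j).toReal := by
  have hs : Summable M := matrix_summable_iff.2 fun i j => by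
    simpa only [hM] using ENNReal.summable_toReal (hB i j)
  have hs' : Summable fun l => M (k + 1 + l) := by
    simpa [add_comm] using (summable_nat_add_iff (k + 1)).2 hs
  rw [seqTail, matrix_tsum_apply hs', ENNReal.tsum_toReal_eq
    fun r => ENNReal.ne_top_of_tsum_ne_top (hB i j) _]
  simp only [hM]

theorem tsum_tsum_ite_eq (n k : ℕ) :
    ∑' l : ℕ, ∑' r : ℕ, (if n = k + 1 + l + 1 + r then (1 : ℝ≥0∞) else 0) =
      ENNReal.ofReal ((n : ℝ) - (k + 1 : ℕ)) := by
  have h1 : ∀ l : ℕ, ∑' r : ℕ, (if n = k + 1 + l + 1 + r then (1 : ℝ≥0∞) else 0) =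
      if l < n - (k + 1) then 1 else 0 := by
    intro l
    split_ifs with h
    · rw [tsum_eq_single (n - (k + 1 + l + 1))]
      · rw [if_pos (by omega)]
      · intro r hr
        rw [if_neg (by omega)]
    · rw [ENNReal.tsum_eq_zero]
      intro r
      rw [if_neg (by omega)]
  simp only [h1]
  rw [tsum_eq_sum (s := Finset.range (n - (k + 1)))]
  · rw [Finset.sum_congr rfl fun l hl => if_pos (Finset.mem_range.1 hl)]
    rw [Finset.sum_const, Finset.card_range, nsmul_eq_mul, mul_one]
    rcases le_total (k + 1) n with h | h
    · rw [← Nat.cast_sub h, ENNReal.ofReal_natCast]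
    · rw [Nat.sub_eq_zero_of_le h, ENNReal.ofReal_of_nonpos, Nat.cast_zero]
      rw [sub_nonpos]
      exact_mod_cast h
  · intro l hl
    rw [if_neg (by simpa using hl)]

namespace IsBMAP

variable {Ω : Type*} [MeasurableSpace Ω] {m : ℕ} {C : Matrix (Fin m) (Fin m) ℝ}
  {D : ℕ → Matrix (Fin m) (Fin m) ℝ} {P : Fin m → Measure Ω}
  {N : ℝ≥0 → Ω → ℕ} {J : ℝ≥0 → Ω → Fin m}

theorem sum_tsum_tsum_eq (h : IsBMAP C D P N J) (H : Measure ℝ≥0) [IsFiniteMeasure H]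
    (k : ℕ) (i : Fin m) :
    ∑ j, ∑' l, ∑' r, ((P i).prod H) {q : Ω × ℝ≥0 | N q.2 q.1 = k + 1 + l + 1 + r ∧ J q.2 q.1 = j} =
      ∫⁻ t, ∫⁻ ω, ENNReal.ofReal ((N t ω : ℝ) - (k + 1 : ℕ)) ∂(P i) ∂H := by
  have := h.prob i
  have hm : Measurable fun q : Ω × ℝ≥0 => (N q.2 q.1, J q.2 q.1) :=
    h.measurable_N.prodMk h.measurable_J
  have hset : ∀ n j, MeasurableSet {q : Ω × ℝ≥0 | N q.2 q.1 = n ∧ J q.2 q.1 = j} := by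
    intro n j
    convert hm (measurableSet_singleton (n, j)) using 1
    ext q
    simp
  have hfun : ∀ n : ℕ, Measurable fun q : Ω × ℝ≥0 =>
      if N q.2 q.1 = n then (1 : ℝ≥0∞) else 0 := fun n =>
    (measurable_of_countable fun a : ℕ => if a = n then (1 : ℝ≥0∞) else 0).comp h.measurable_N
  have h1 : ∀ n, ∑ j, ((P i).prod H) {q : Ω × ℝ≥0 | N q.2 q.1 = n ∧ J q.2 q.1 = j} =
      ∫⁻ q : Ω × ℝ≥0, (if N q.2 q.1 = n then 1 else 0) ∂((P i).prod H) := by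
    intro n
    have e : ∀ j, ((P i).prod H) {q : Ω × ℝ≥0 | N q.2 q.1 = n ∧ J q.2 q.1 = j} =
        ∫⁻ q : Ω × ℝ≥0, ({q : Ω × ℝ≥0 | N q.2 q.1 = n ∧ J q.2 q.1 = j}.indicator 1 q)
          ∂((P i).prod H) := fun j => (lintegral_indicator_one (hset n j)).symm
    simp only [e]
    rw [← lintegral_finsetSum _ fun j _ => measurable_one.indicator (hset n j)]
    refine lintegral_congr fun q => ?_
    simp only [indicator_apply, mem_ofPred_eq, Pi.one_apply]
    by_cases hn : N q.2 q.1 = n <;> simp [hn]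
  have h2 : ∑ j, ∑' l, ∑' r, ((P i).prod H)
      {q : Ω × ℝ≥0 | N q.2 q.1 = k + 1 + l + 1 + r ∧ J q.2 q.1 = j} =
      ∑' l, ∑' r, ∑ j, ((P i).prod H)
        {q : Ω × ℝ≥0 | N q.2 q.1 = k + 1 + l + 1 + r ∧ J q.2 q.1 = j} := by
    simp only [← tsum_fintype (L := .unconditional _)]
    rw [ENNReal.tsum_comm]
    exact tsum_congr fun l => ENNReal.tsum_comm
  rw [h2]
  simp only [h1]
  have h3 : ∀ l, ∑' r, ∫⁻ q : Ω × ℝ≥0, (if N q.2 q.1 = k + 1 + l + 1 + r then (1 : ℝ≥0∞) else 0)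
      ∂((P i).prod H) = ∫⁻ q : Ω × ℝ≥0, ∑' r,
        (if N q.2 q.1 = k + 1 + l + 1 + r then (1 : ℝ≥0∞) else 0) ∂((P i).prod H) := fun l =>
    (lintegral_tsum fun r => (hfun _).aemeasurable).symm
  simp only [h3]
  rw [← lintegral_tsum fun l => (Measurable.tsum fun r => hfun _).aemeasurable]
  simp only [tsum_tsum_ite_eq]
  have hg : Measurable fun q : Ω × ℝ≥0 => ENNReal.ofReal ((N q.2 q.1 : ℝ) - (k + 1 : ℕ)) :=
    (measurable_of_countable fun a : ℕ => ENNReal.ofReal ((a : ℝ) - (k + 1 : ℕ))).comp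
      h.measurable_N
  rw [lintegral_prod_symm _ hg.aemeasurable]

theorem tsum_tsum_lt_top_of_mean (h : IsBMAP C D P N J) (H : Measure ℝ≥0) [IsFiniteMeasure H]
    (hfin : ∀ i, ∫⁻ t, ∫⁻ ω, ENNReal.ofReal ((N t ω : ℝ) - (0 + 1 : ℕ)) ∂(P i) ∂H ≠ ⊤)
    (i j : Fin m) :
    ∑' n, ∑' r, ((P i).prod H) {q : Ω × ℝ≥0 | N q.2 q.1 = n + 1 + r ∧ J q.2 q.1 = j} ≠ ⊤ := by
  have := h.prob i
  have h0 := h.sum_tsum_tsum_eq H 0 i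
  have h1 : ∑' l, ∑' r, ((P i).prod H)
      {q : Ω × ℝ≥0 | N q.2 q.1 = 0 + 1 + l + 1 + r ∧ J q.2 q.1 = j} ≠ ⊤ := by
    refine ne_top_of_le_ne_top (hfin i) (h0 ▸ ?_)
    exact Finset.single_le_sum (f := fun j => ∑' l, ∑' r, ((P i).prod H)
      {q : Ω × ℝ≥0 | N q.2 q.1 = 0 + 1 + l + 1 + r ∧ J q.2 q.1 = j}) (fun _ _ => zero_le)
      (Finset.mem_univ j)
  rw [tsum_eq_zero_add' ENNReal.summable]
  refine ENNReal.add_ne_top.2 ⟨?_, ?_⟩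
  · have hm : Measurable fun q : Ω × ℝ≥0 => (N q.2 q.1, J q.2 q.1) :=
      h.measurable_N.prodMk h.measurable_J
    refine ne_top_of_le_ne_top (measure_ne_top ((P i).prod H) univ) ?_
    rw [← measure_iUnion]
    · exact measure_mono (subset_univ _)
    · intro a b hab
      rw [Function.onFun, Set.disjoint_left]
      rintro q ⟨h2, _⟩ ⟨h3, _⟩
      omega
    · intro r
      convert hm (measurableSet_singleton (0 + 1 + r, j)) using 1
      ext q
      simp
  · convert h1 using 8
    omega

/-- Row `i` of the double tail is the mean excess of the number of arrivals during a service. -/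
theorem doubleTail_mulVec_one (h : IsBMAP C D P N J) (H : Measure ℝ≥0) [IsFiniteMeasure H]
    (hfin : ∀ i, ∫⁻ t, ∫⁻ ω, ENNReal.ofReal ((N t ω : ℝ) - (0 + 1 : ℕ)) ∂(P i) ∂H ≠ ⊤)
    (k : ℕ) (i : Fin m) :
    (seqTail (seqTail (serviceArrivals P N J H)) k *ᵥ 1) i =
      (∫⁻ t, ∫⁻ ω, ENNReal.ofReal ((N t ω : ℝ) - (k + 1 : ℕ)) ∂(P i) ∂H).toReal := by
  have := h.prob
  have hB2 := h.tsum_tsum_lt_top_of_mean H hfin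
  have hB1 : ∀ i j, ∑' n, ((P i).prod H) {q : Ω × ℝ≥0 | N q.2 q.1 = n ∧ J q.2 q.1 = j} ≠ ⊤ := by
    intro i j
    rw [tsum_eq_zero_add' ENNReal.summable]
    refine ENNReal.add_ne_top.2 ⟨measure_ne_top _ _, ?_⟩
    have := ENNReal.ne_top_of_tsum_ne_top (hB2 i j) 0
    convert this using 7
    omega
  have e1 := seqTail_apply_eq_toReal (M := serviceArrivals P N J H)
    (B := fun n i j => ((P i).prod H) {q : Ω × ℝ≥0 | N q.2 q.1 = n ∧ J q.2 q.1 = j})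
    (fun _ _ _ => rfl) hB1
  have e2 := seqTail_apply_eq_toReal (M := seqTail (serviceArrivals P N J H))
    (B := fun n i j => ∑' r, ((P i).prod H)
      {q : Ω × ℝ≥0 | N q.2 q.1 = n + 1 + r ∧ J q.2 q.1 = j}) e1 hB2
  rw [← h.sum_tsum_tsum_eq H k i, ENNReal.toReal_sum]
  · simp only [Matrix.mulVec, dotProduct, Pi.one_apply, mul_one]
    exact Finset.sum_congr rfl fun j _ => e2 k i j
  · intro j _
    refine ne_top_of_le_ne_top (hB2 i j) ?_
    exact ENNReal.tsum_comp_le_tsum_of_injective (add_right_injective (k + 1)) (fun n => ∑' r,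
      ((P i).prod H) {q : Ω × ℝ≥0 | N q.2 q.1 = n + 1 + r ∧ J q.2 q.1 = j})

/-! ### Comparison of the double tail with the mean excess of the service time -/

/-- The bound on the conditional mean excess given `T = t`, in the form that is integrated over the
service time. Below the level `k` it is the moderate deviation bound at scale `k`; above the level,
the fluctuation `√(λ t) ≤ √k + (λ t - k) / √k` is added to the excess of the mean. -/
theorem exists_lintegral_sub_le_excess (h : IsBMAP C D P N J) (hD : IsBMAPParam C D)
    {p : Fin m → ℝ} (hp : IsStationaryVector (C + ∑' k, D k) p) (hlam : 0 < arrivalRate p D)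
    (hb : BatchTailBound D) :
    ∃ η : ℝ, 0 < η ∧ ∃ A : ℝ, 0 ≤ A ∧ ∀ (i : Fin m) (t : ℝ≥0) (k : ℝ), 1 ≤ k →
      ∫⁻ ω, ENNReal.ofReal (N t ω - k) ∂(P i) ≤
        ENNReal.ofReal (max (arrivalRate p D * t - k) 0 * (1 + A / Real.sqrt k) +
          A * (Real.sqrt k * min 1 (Real.exp (-(η * (Real.sqrt k -
            Real.sqrt (arrivalRate p D * t)))))) + A * t * Real.exp (-(η * Real.sqrt k))) := by
  obtain ⟨η, hη, A, hA, hle⟩ := h.exists_lintegral_sub_le hD hp hlam hb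
  refine ⟨η, hη, A, hA, fun i t k hk => ?_⟩
  set lam := arrivalRate p D
  have hk0 : 0 < k := by linarith
  have hr0 : 0 < Real.sqrt k := Real.sqrt_pos.2 hk0
  have hrk : Real.sqrt k ^ 2 = k := Real.sq_sqrt hk0.le
  have ht0 : (0 : ℝ) ≤ t := t.2
  have hlt0 : 0 ≤ lam * t := by positivity
  have hS0 := Real.sqrt_nonneg (lam * t)
  have hS2 : Real.sqrt (lam * t) ^ 2 = lam * t := Real.sq_sqrt hlt0
  rcases le_or_gt (lam * t) k with hc | hc
  · refine (hle i t k k hk hk0.le hc).trans (ENNReal.ofReal_le_ofReal ?_)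
    have hSk : Real.sqrt (lam * t) ≤ Real.sqrt k := Real.sqrt_le_sqrt hc
    rw [max_eq_right (by linarith), zero_mul, zero_add,
      min_eq_right (Real.exp_le_one_iff.2 (by nlinarith)), ← mul_assoc]
    refine add_le_add (mul_le_mul_of_nonneg_left (Real.exp_le_exp.2 ?_) (by positivity)) le_rfl
    refine neg_le_neg (mul_le_mul_of_nonneg_left ?_ hη.le)
    rw [le_div_iff₀ hr0]
    nlinarith
  · have h1 := hle i t (lam * t) (lam * t) (hk.trans hc.le) hlt0 le_rfl
    have hSk : Real.sqrt k ≤ Real.sqrt (lam * t) := Real.sqrt_le_sqrt hc.le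
    rw [sub_self, zero_div, mul_zero, neg_zero, Real.exp_zero, mul_one] at h1
    have := h.prob i
    calc ∫⁻ ω, ENNReal.ofReal (N t ω - k) ∂(P i)
        ≤ ∫⁻ ω, (ENNReal.ofReal (N t ω - lam * t) + ENNReal.ofReal (lam * t - k)) ∂(P i) := by
          refine lintegral_mono fun ω => ?_
          have e : (N t ω : ℝ) - k = (N t ω - lam * t) + (lam * t - k) := by ring
          rw [e]
          exact ENNReal.ofReal_add_le
      _ ≤ ENNReal.ofReal (A * Real.sqrt (lam * t) + A * t *
            Real.exp (-(η * Real.sqrt (lam * t)))) + ENNReal.ofReal (lam * t - k) := by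
          rw [lintegral_add_right _ measurable_const, lintegral_const, measure_univ, mul_one]
          gcongr
      _ ≤ _ := by
          rw [← ENNReal.ofReal_add (by positivity) (by linarith)]
          refine ENNReal.ofReal_le_ofReal ?_
          rw [max_eq_left (by linarith), min_eq_left (Real.one_le_exp (by nlinarith)), mul_one]
          have h2 : Real.sqrt (lam * t) ≤ Real.sqrt k + (lam * t - k) / Real.sqrt k := by
            rw [← sub_le_iff_le_add', le_div_iff₀ hr0]
            nlinarith
          have h3 : Real.exp (-(η * Real.sqrt (lam * t))) ≤ Real.exp (-(η * Real.sqrt k)) :=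
            Real.exp_le_exp.2 (by nlinarith)
          have h4 := mul_le_mul_of_nonneg_left h2 hA
          have h5 := mul_le_mul_of_nonneg_left h3 (by positivity : 0 ≤ A * t)
          have e : (lam * t - k) * (1 + A / Real.sqrt k) =
              (lam * t - k) + A * ((lam * t - k) / Real.sqrt k) := by ring
          rw [e]
          linarith

/-- The mean excess of the number of arrivals during a service lies between two quantities that are
asymptotically equivalent to the mean excess of `λ T`. -/
theorem exists_doubleTail_bounds (h : IsBMAP C D P N J) (hD : IsBMAPParam C D)
    {p : Fin m → ℝ} (hp : IsStationaryVector (C + ∑' k, D k) p) (hlam : 0 < arrivalRate p D)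
    (hb : BatchTailBound D) {H : Measure ℝ≥0} (hH : IsServiceLaw H) :
    ∃ η : ℝ, 0 < η ∧ ∃ A c : ℝ, 0 ≤ A ∧ 0 ≤ c ∧ ∀ (i : Fin m) (k : ℕ), 1 ≤ k →
      meanExcess H (arrivalRate p D) (k + 1 + c) ≤
        (seqTail (seqTail (serviceArrivals P N J H)) k *ᵥ 1) i ∧
      (seqTail (seqTail (serviceArrivals P N J H)) k *ᵥ 1) i ≤
        meanExcess H (arrivalRate p D) k * (1 + A / Real.sqrt k) +
          A * smoothTail H (arrivalRate p D) η (Real.sqrt k) := by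
  have := hH.prob
  obtain ⟨η, hη, A, hA, hup⟩ := h.exists_lintegral_sub_le_excess hD hp hlam hb
  obtain ⟨c, hc, hlow⟩ := h.exists_le_lintegral_sub hD hp hlam hb
  set lam := arrivalRate p D
  have hh : 0 < meanService H := hH.mean_pos
  have hupper : ∀ (i : Fin m) (k : ℝ), 1 ≤ k →
      ∫⁻ t, ∫⁻ ω, ENNReal.ofReal (N t ω - k) ∂(P i) ∂H ≤
      ENNReal.ofReal (meanExcess H lam k * (1 + A / Real.sqrt k) +
          (A * (1 + meanService H)) * smoothTail H lam η (Real.sqrt k)) := by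
    intro i k hk
    have hr1 : 1 ≤ Real.sqrt k := Real.one_le_sqrt.2 hk
    have i1 : Integrable (fun t : ℝ≥0 => max (lam * t - k) 0 * (1 + A / Real.sqrt k)) H :=
      (integrable_excess hH.integrable lam k).mul_const _
    have i2 : Integrable (fun t : ℝ≥0 => A * (Real.sqrt k * min 1 (Real.exp (-(η * (Real.sqrt k -
        Real.sqrt (lam * t))))))) H := (integrable_smoothTail H lam η _).const_mul A
    have i3 : Integrable (fun t : ℝ≥0 => A * t * Real.exp (-(η * Real.sqrt k))) H :=
      (hH.integrable.const_mul A).mul_const _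
    have i12 : Integrable (fun t : ℝ≥0 => max (lam * t - k) 0 * (1 + A / Real.sqrt k) +
        A * (Real.sqrt k * min 1 (Real.exp (-(η * (Real.sqrt k -
        Real.sqrt (lam * t))))))) H := i1.add i2
    have i123 : Integrable (fun t : ℝ≥0 => max (lam * t - k) 0 * (1 + A / Real.sqrt k) +
        A * (Real.sqrt k * min 1 (Real.exp (-(η * (Real.sqrt k -
        Real.sqrt (lam * t)))))) + A * t * Real.exp (-(η * Real.sqrt k))) H := i12.add i3
    have hb0 : ∀ t : ℝ≥0, 0 ≤ min 1 (Real.exp (-(η * (Real.sqrt k - Real.sqrt (lam * t))))) :=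
      fun t => le_min zero_le_one (Real.exp_pos _).le
    refine (lintegral_mono fun t => hup i t k hk).trans ?_
    rw [← ofReal_integral_eq_lintegral_ofReal i123 (ae_of_all _ fun t => ?_)]
    · refine ENNReal.ofReal_le_ofReal ?_
      have e1 : ∫ t : ℝ≥0, A * (Real.sqrt k * min 1 (Real.exp (-(η * (Real.sqrt k -
          Real.sqrt (lam * t)))))) ∂H = A * smoothTail H lam η (Real.sqrt k) :=
        integral_const_mul A _
      have e2 : ∫ t : ℝ≥0, A * (t : ℝ) ∂H = A * meanService H := integral_const_mul A _
      rw [integral_add i12 i3, integral_add i1 i2, integral_mul_const, e1,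
        integral_mul_const, e2]
      have e : Real.exp (-(η * Real.sqrt k)) ≤ smoothTail H lam η (Real.sqrt k) := by
        calc Real.exp (-(η * Real.sqrt k)) = ∫ _ : ℝ≥0, Real.exp (-(η * Real.sqrt k)) ∂H := by
              simp
          _ ≤ _ := by
              refine integral_mono (integrable_const _) (integrable_smoothTail H lam η _)
                fun t => ?_
              refine le_trans (le_min (Real.exp_le_one_iff.2 (by nlinarith))
                (Real.exp_le_exp.2 ?_)) (le_mul_of_one_le_left (hb0 t) hr1)
              nlinarith [Real.sqrt_nonneg (lam * t)]
      change meanExcess H lam k * _ + A * smoothTail H lam η (Real.sqrt k) +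
        A * meanService H * _ ≤ _
      have := mul_le_mul_of_nonneg_left e (by positivity : 0 ≤ A * meanService H)
      nlinarith
    · have h1 : 0 ≤ max (lam * t - k) 0 := le_max_right _ _
      have h2 := hb0 t
      have h3 : (0 : ℝ) ≤ t := t.2
      change 0 ≤ max (lam * t - k) 0 * (1 + A / Real.sqrt k) +
        A * (Real.sqrt k * min 1 (Real.exp (-(η * (Real.sqrt k -
        Real.sqrt (lam * t)))))) + A * t * Real.exp (-(η * Real.sqrt k))
      positivity
  have hfin : ∀ i, ∫⁻ t, ∫⁻ ω, ENNReal.ofReal ((N t ω : ℝ) - (0 + 1 : ℕ)) ∂(P i) ∂H ≠ ⊤ := by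
    intro i
    refine ne_top_of_le_ne_top ENNReal.ofReal_ne_top (hupper i ((0 + 1 : ℕ) : ℝ) (by simp))
  refine ⟨η, hη, A * (1 + meanService H), c, by positivity, hc, fun i k hk => ?_⟩
  have hk1 : (1 : ℝ) ≤ k := by exact_mod_cast hk
  rw [h.doubleTail_mulVec_one H hfin]
  have hle : ∫⁻ t, ∫⁻ ω, ENNReal.ofReal ((N t ω : ℝ) - (k + 1 : ℕ)) ∂(P i) ∂H ≤
      ∫⁻ t, ∫⁻ ω, ENNReal.ofReal ((N t ω : ℝ) - k) ∂(P i) ∂H := by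
    refine lintegral_mono fun t => lintegral_mono fun ω => ENNReal.ofReal_le_ofReal ?_
    push_cast
    linarith
  have hle2 := hle.trans (hupper i k hk1)
  constructor
  · have h1 : ENNReal.ofReal (meanExcess H lam (k + 1 + c)) ≤
        ∫⁻ t, ∫⁻ ω, ENNReal.ofReal ((N t ω : ℝ) - (k + 1 : ℕ)) ∂(P i) ∂H := by
      rw [meanExcess, ofReal_integral_eq_lintegral_ofReal
        (integrable_excess hH.integrable lam _) (ae_of_all _ fun t => le_max_right _ _)]
      refine lintegral_mono fun t => ?_
      refine le_trans (le_of_eq ?_) (hlow i t ((k + 1 : ℕ) : ℝ) (by positivity))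
      rw [ENNReal.ofReal_max, ENNReal.ofReal_zero, max_eq_left zero_le]
      congr 1
      push_cast
      ring
    exact (ENNReal.ofReal_le_iff_le_toReal (ne_top_of_le_ne_top ENNReal.ofReal_ne_top hle2)).1 h1
  · refine ENNReal.toReal_le_of_le_ofReal ?_ (hle2.trans (ENNReal.ofReal_le_ofReal ?_))
    · have h1 := meanExcess_nonneg H lam k
      have h2 := smoothTail_nonneg H lam η (Real.sqrt_nonneg (k : ℝ))
      positivity
    · have h1 : A / Real.sqrt k ≤ A * (1 + meanService H) / Real.sqrt k := by
        gcongr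
        nlinarith
      have h2 := mul_le_mul_of_nonneg_left h1 (meanExcess_nonneg H lam k)
      nlinarith

theorem tendsto_doubleTail_div_meanExcess (h : IsBMAP C D P N J) {p : Fin m → ℝ}
    {H : Measure ℝ≥0} (hyp : SubexpHypotheses C D p H) (i : Fin m) :
    Tendsto (fun k : ℕ => (seqTail (seqTail (serviceArrivals P N J H)) k *ᵥ 1) i /
      meanExcess H (arrivalRate p D) k) atTop (𝓝 1) := by
  have hH := hyp.service
  have hlam := hyp.rate_pos
  have hL := hyp.sqrt_longTailed
  obtain ⟨η, hη, A, c, hA, hc, hbd⟩ :=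
    h.exists_doubleTail_bounds hyp.bmap hyp.stationary hlam hyp.batch hH
  set lam := arrivalRate p D
  have hpos : ∀ k : ℕ, 0 < meanExcess H lam k := fun k =>
    meanExcess_pos hH hlam hL k.cast_nonneg
  have hs : Tendsto (fun k : ℕ => Real.sqrt k) atTop atTop :=
    Real.tendsto_sqrt_atTop.comp tendsto_natCast_atTop_atTop
  have hlow := (tendsto_meanExcess_sq hH hlam hL).comp hs
  have hup : Tendsto (fun k : ℕ => (1 + A / Real.sqrt k) + A *
      (smoothTail H lam η (Real.sqrt k) / meanExcess H lam (Real.sqrt k ^ 2))) atTop (𝓝 1) := by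
    have h1 := ((hs.const_div_atTop A).const_add 1).add
      (((tendsto_smoothTail_div hH hlam hL hη).comp hs).const_mul A)
    simpa using h1
  refine tendsto_of_tendsto_of_tendsto_of_le_of_le' hlow hup ?_ ?_
  · filter_upwards [hs.eventually_ge_atTop c, eventually_ge_atTop 1] with k hk hk1
    have h2 := (hbd i k hk1).1
    have hk2 : Real.sqrt k ^ 2 = k := Real.sq_sqrt k.cast_nonneg
    simp only [Function.comp, hk2]
    refine div_le_div_of_nonneg_right (le_trans ?_ h2) (hpos k).le
    refine meanExcess_antitone hH lam ?_
    nlinarith [Real.sqrt_nonneg (k : ℝ)]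
  · filter_upwards [eventually_ge_atTop 1] with k hk1
    have h2 := (hbd i k hk1).2
    have hk2 : Real.sqrt k ^ 2 = k := Real.sq_sqrt k.cast_nonneg
    rw [hk2, div_le_iff₀ (hpos k)]
    refine h2.trans (le_of_eq ?_)
    have := (hpos k).ne'
    field_simp

/-- The double tail asymptotics with respect to the law of `λ T_e`. -/
theorem hasDoubleTailLimit (h : IsBMAP C D P N J) {p : Fin m → ℝ}
    {H : Measure ℝ≥0} (hyp : SubexpHypotheses C D p H) :
    HasDoubleTailLimit (serviceArrivals P N J H)
      ((equilibriumLaw H).map (fun x => arrivalRate p D * x))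
      (fun _ => arrivalRate p D * meanService H) := by
  intro i
  have hlam := hyp.rate_pos
  have hh : 0 < meanService H := hyp.service.mean_pos
  have h1 := (h.tendsto_doubleTail_div_meanExcess hyp i).const_mul
    (arrivalRate p D * meanService H)
  rw [mul_one] at h1
  refine h1.congr fun k => ?_
  rw [tailProb_map_const_mul _ hlam, meanExcess_eq_mul_tailProb hyp.service hlam k.cast_nonneg]
  by_cases h0 : tailProb (equilibriumLaw H) (k / arrivalRate p D) = 0
  · simp [h0]
  · field_simp

end IsBMAP

/-! ### Subexponentiality under scaling and rounding -/

theorem tailProb_conv (μ : Measure ℝ) (x : ℝ) :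
    tailProb (μ.conv μ) x = (μ.prod μ).real {z | x < z.1 + z.2} := by
  rw [tailProb, Measure.conv, map_measureReal_apply (by fun_prop) measurableSet_Ioi]
  rfl

theorem IsSubexponential.map_const_mul {μ : Measure ℝ} (h : IsSubexponential μ) {c : ℝ}
    (hc : 0 < c) : IsSubexponential (μ.map fun x => c * x) := by
  have := h.prob
  have hconv : (μ.map fun x => c * x).conv (μ.map fun x => c * x) =
      (μ.conv μ).map fun x => c * x :=
    (Measure.map_conv_addMonoidHom (μ := μ) (ν := μ) (AddMonoidHom.mulLeft c)
      (measurable_const_mul c)).symm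
  refine ⟨Measure.isProbabilityMeasure_map (by fun_prop), ?_, fun x hx => ?_, ?_⟩
  · rw [Measure.map_apply (by fun_prop) measurableSet_Iio]
    convert h.nonneg using 2
    ext y
    simp [hc]
  · rw [tailProb_map_const_mul _ hc]
    exact h.tail_pos _ (by positivity)
  · rw [hconv]
    simp only [tailProb_map_const_mul _ hc]
    exact h.tendsto_ratio.comp (tendsto_id.atTop_div_const hc)

/-- If the square root is long-tailed, then so is the variable itself. -/
theorem tendsto_tailProb_add_of_sqrt {μ : Measure ℝ} [IsFiniteMeasure μ]
    (h : IsLongTailed (μ.map Real.sqrt)) {z : ℝ} (hz : 0 ≤ z) :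
    Tendsto (fun x => tailProb μ (x + z) / tailProb μ x) atTop (𝓝 1) := by
  have hpos : ∀ x, 0 ≤ x → 0 < tailProb μ x := fun x hx => by
    have h1 := h.tail_pos (Real.sqrt x) (Real.sqrt_nonneg _)
    rwa [tailProb_map_sqrt _ (Real.sqrt_nonneg _), Real.sq_sqrt hx] at h1
  have h1 := (h.tendsto_shift zero_le_one).comp Real.tendsto_sqrt_atTop
  refine tendsto_of_tendsto_of_tendsto_of_le_of_le' h1 tendsto_const_nhds ?_ ?_
  · filter_upwards [Real.tendsto_sqrt_atTop.eventually_ge_atTop z, eventually_ge_atTop 0]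
      with x hx hx0
    have hs := Real.sqrt_nonneg x
    have hs2 := Real.sq_sqrt hx0
    simp only [Function.comp]
    rw [tailProb_map_sqrt _ (by positivity), tailProb_map_sqrt _ hs, hs2]
    refine div_le_div_of_nonneg_right (tailProb_antitone μ ?_) (hpos x hx0).le
    nlinarith
  · filter_upwards [eventually_ge_atTop 0] with x hx
    rw [div_le_one (hpos x hx)]
    exact tailProb_antitone μ (by linarith)

theorem tailProb_floor_le (ν : Measure ℝ) [IsFiniteMeasure ν] {x : ℝ} (hx : 0 ≤ x) :
    tailProb (ν.map fun y => (⌊y⌋₊ : ℝ)) x ≤ tailProb ν x := by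
  rw [tailProb, map_measureReal_apply (by fun_prop) measurableSet_Ioi]
  refine measureReal_mono fun y (hy : x < ⌊y⌋₊) => ?_
  rcases le_total 0 y with h | h
  · exact hy.trans_le (Nat.floor_le h)
  · rw [Nat.floor_of_nonpos h, Nat.cast_zero] at hy
    linarith

theorem le_tailProb_floor (ν : Measure ℝ) [IsFiniteMeasure ν] (x : ℝ) :
    tailProb ν (x + 1) ≤ tailProb (ν.map fun y => (⌊y⌋₊ : ℝ)) x := by
  rw [tailProb, tailProb, map_measureReal_apply (by fun_prop) measurableSet_Ioi]
  refine measureReal_mono fun y (hy : x + 1 < y) => ?_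
  have := Nat.lt_floor_add_one y
  change x < (⌊y⌋₊ : ℝ)
  linarith

theorem tendsto_tailProb_floor_div {ν : Measure ℝ} [IsFiniteMeasure ν]
    (hpos : ∀ x, 0 ≤ x → 0 < tailProb ν x)
    (hlong : Tendsto (fun x => tailProb ν (x + 1) / tailProb ν x) atTop (𝓝 1)) :
    Tendsto (fun x => tailProb (ν.map fun y => (⌊y⌋₊ : ℝ)) x / tailProb ν x) atTop (𝓝 1) := by
  refine tendsto_of_tendsto_of_tendsto_of_le_of_le' hlong tendsto_const_nhds ?_ ?_
  · filter_upwards [eventually_ge_atTop 0] with x hx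
    exact div_le_div_of_nonneg_right (le_tailProb_floor ν x) (hpos x hx).le
  · filter_upwards [eventually_ge_atTop 0] with x hx
    rw [div_le_one (hpos x hx)]
    exact tailProb_floor_le ν hx

/-- The integer part of a long-tailed subexponential variable is subexponential: two roundings
shift the sum by at most two. -/
theorem IsSubexponential.map_floor {ν : Measure ℝ} (h : IsSubexponential ν)
    (hlong : ∀ z, 0 ≤ z → Tendsto (fun x => tailProb ν (x + z) / tailProb ν x) atTop (𝓝 1)) :
    IsSubexponential (ν.map fun y => (⌊y⌋₊ : ℝ)) := by
  have := h.prob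
  have hf : Measurable fun y : ℝ => (⌊y⌋₊ : ℝ) := by fun_prop
  have hfl := tendsto_tailProb_floor_div h.tail_pos (hlong 1 zero_le_one)
  have hpos : ∀ x, 0 ≤ x → 0 < tailProb (ν.map fun y => (⌊y⌋₊ : ℝ)) x := fun x hx =>
    (h.tail_pos _ (by linarith)).trans_le (le_tailProb_floor ν x)
  have hconv : ∀ x, tailProb ((ν.map fun y => (⌊y⌋₊ : ℝ)).conv (ν.map fun y => (⌊y⌋₊ : ℝ))) x =
      (ν.prod ν).real {z | x < (⌊z.1⌋₊ : ℝ) + ⌊z.2⌋₊} := by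
    intro x
    rw [tailProb_conv, Measure.map_prod_map ν ν hf hf, map_measureReal_apply (by fun_prop)
      (measurableSet_lt measurable_const (by fun_prop))]
    rfl
  have hae : ∀ᵐ y ∂ν, 0 ≤ y := by
    rw [ae_iff]
    simpa [Iio] using h.nonneg
  have hae1 : ∀ᵐ z ∂(ν.prod ν), 0 ≤ z.1 := Measure.quasiMeasurePreserving_fst.ae hae
  have hae2 : ∀ᵐ z ∂(ν.prod ν), 0 ≤ z.2 := Measure.quasiMeasurePreserving_snd.ae hae
  refine ⟨Measure.isProbabilityMeasure_map hf.aemeasurable, ?_, hpos, ?_⟩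
  · rw [Measure.map_apply hf measurableSet_Iio]
    convert measure_empty (μ := ν)
    rw [Set.eq_empty_iff_forall_notMem]
    intro y hy
    exact absurd (show ((⌊y⌋₊ : ℝ)) < 0 from hy) (not_lt.2 (Nat.cast_nonneg _))
  · have hup := h.tendsto_ratio.mul (hfl.inv₀ one_ne_zero)
    have hlow := ((h.tendsto_ratio.comp (tendsto_atTop_add_const_right atTop (2 : ℝ) tendsto_id)).mul
      (hlong 2 zero_le_two))
    rw [inv_one, mul_one] at hup
    rw [mul_one] at hlow
    refine tendsto_of_tendsto_of_tendsto_of_le_of_le' hlow hup ?_ ?_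
    · filter_upwards [eventually_ge_atTop 0] with x hx
      have p1 := h.tail_pos (x + 2) (by linarith)
      have p2 := h.tail_pos x hx
      have p3 := hpos x hx
      have h1 : tailProb (ν.conv ν) (x + 2) ≤
          tailProb ((ν.map fun y => (⌊y⌋₊ : ℝ)).conv (ν.map fun y => (⌊y⌋₊ : ℝ))) x := by
        rw [hconv, tailProb_conv]
        refine measureReal_mono fun z (hz : x + 2 < z.1 + z.2) => ?_
        have h2 := Nat.lt_floor_add_one z.1
        have h3 := Nat.lt_floor_add_one z.2
        change x < (⌊z.1⌋₊ : ℝ) + ⌊z.2⌋₊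
        linarith
      simp only [Function.comp, id]
      rw [div_mul_div_cancel₀ p1.ne']
      exact div_le_div₀ measureReal_nonneg h1 p3 (tailProb_floor_le ν hx)
    · filter_upwards [eventually_ge_atTop 0] with x hx
      have p2 := h.tail_pos x hx
      have p3 := hpos x hx
      have h1 : tailProb ((ν.map fun y => (⌊y⌋₊ : ℝ)).conv (ν.map fun y => (⌊y⌋₊ : ℝ))) x ≤
          tailProb (ν.conv ν) x := by
        rw [hconv, tailProb_conv]
        refine ENNReal.toReal_mono (measure_ne_top _ _) (measure_mono_ae ?_)
        filter_upwards [hae1, hae2] with z h2 h3 (hz : x < (⌊z.1⌋₊ : ℝ) + ⌊z.2⌋₊)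
        have h4 := Nat.floor_le h2
        have h5 := Nat.floor_le h3
        change x < z.1 + z.2
        linarith
      rw [inv_div, div_mul_div_cancel₀ p2.ne']
      exact div_le_div_of_nonneg_right h1 p3.le

/-! ### A Pareto service time -/

/-- The service law with tail `ℙ(T > y) = (a / (a + y))²`, as the law of `a (1 / √U - 1)` for a
uniform `U`. -/
noncomputable def paretoService (a : ℝ) : Measure ℝ≥0 :=
  (volume.restrict (Ioc (0 : ℝ) 1)).map fun u => (a * (1 / Real.sqrt u - 1)).toNNReal

instance isProbabilityMeasure_paretoService (a : ℝ) : IsProbabilityMeasure (paretoService a) := by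
  have : IsProbabilityMeasure (volume.restrict (Ioc (0 : ℝ) 1)) := ⟨by simp⟩
  exact Measure.isProbabilityMeasure_map (by fun_prop)

theorem paretoService_tail {a : ℝ} (ha : 0 < a) {y : ℝ} (hy : 0 ≤ y) :
    paretoService a {t : ℝ≥0 | y < (t : ℝ)} = ENNReal.ofReal ((a / (a + y)) ^ 2) := by
  have hm : Measurable fun u : ℝ => (a * (1 / Real.sqrt u - 1)).toNNReal := by fun_prop
  have hq : a / (a + y) ≤ 1 := (div_le_one (by linarith)).2 (by linarith)
  have hq0 : 0 < a / (a + y) := by positivity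
  have hset : (fun u : ℝ => (a * (1 / Real.sqrt u - 1)).toNNReal) ⁻¹' {t : ℝ≥0 | y < (t : ℝ)} ∩
      Ioc 0 1 = Ioo 0 ((a / (a + y)) ^ 2) := by
    ext u
    simp only [mem_inter_iff, mem_preimage, mem_ofPred_eq, mem_Ioc, mem_Ioo]
    have key : 0 < u → (y < a * (1 / Real.sqrt u - 1) ↔ u < (a / (a + y)) ^ 2) := by
      intro hu
      have hs : 0 < Real.sqrt u := Real.sqrt_pos.2 hu
      rw [← Real.sqrt_lt' hq0, lt_div_iff₀ (by linarith)]
      have e : a * (1 / Real.sqrt u - 1) = (a - a * Real.sqrt u) / Real.sqrt u := by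
        field_simp
      rw [e, lt_div_iff₀ hs]
      constructor <;> intro h <;> nlinarith
    rw [Real.coe_toNNReal']
    constructor
    · rintro ⟨h1, h2, h3⟩
      rcases lt_max_iff.1 h1 with h | h
      · exact ⟨h2, (key h2).1 h⟩
      · linarith
    · rintro ⟨h1, h2⟩
      refine ⟨lt_max_of_lt_left ((key h1).2 h2), h1, ?_⟩
      exact h2.le.trans (pow_le_one₀ hq0.le hq)
  have hms : MeasurableSet {t : ℝ≥0 | y < (t : ℝ)} :=
    measurableSet_lt measurable_const NNReal.continuous_coe.measurable
  rw [paretoService, Measure.map_apply hm hms, Measure.restrict_apply (hm hms), hset]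
  simp

theorem paretoService_lintegral_tail {a : ℝ} (ha : 0 < a) {x : ℝ} (hx : 0 ≤ x) :
    ∫⁻ y in Ioi x, paretoService a {t : ℝ≥0 | y < (t : ℝ)} = ENNReal.ofReal (a ^ 2 / (a + x)) := by
  have e1 : ∫⁻ y in Ioi x, paretoService a {t : ℝ≥0 | y < (t : ℝ)} =
      ∫⁻ y in Ioi x, ENNReal.ofReal ((a / (a + y)) ^ 2) :=
    setLIntegral_congr_fun measurableSet_Ioi fun y hy =>
      paretoService_tail ha (hx.trans (le_of_lt hy))
  have hderiv : ∀ y ∈ Ici x, HasDerivAt (fun y => -(a ^ 2 / (a + y))) ((a / (a + y)) ^ 2) y := by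
    intro y hy
    have hne : a + y ≠ 0 := by
      have : x ≤ y := hy
      linarith
    have := ((hasDerivAt_const y (a ^ 2)).div ((hasDerivAt_id y).const_add a) hne).neg
    refine this.congr_deriv ?_
    simp only [id]
    field_simp
    ring
  have hlim : Tendsto (fun y : ℝ => -(a ^ 2 / (a + y))) atTop (𝓝 0) := by
    have := ((tendsto_atTop_add_const_left atTop a tendsto_id).const_div_atTop (a ^ 2)).neg
    simpa using this
  have hnn : ∀ y ∈ Ioi x, 0 ≤ (a / (a + y)) ^ 2 := fun y _ => sq_nonneg _
  rw [e1, ← ofReal_integral_eq_lintegral_ofReal (integrableOn_Ioi_deriv_of_nonneg' hderiv hnn hlim)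
    (ae_of_all _ fun y => sq_nonneg _), integral_Ioi_of_hasDerivAt_of_nonneg' hderiv hnn hlim]
  congr 1
  ring

theorem paretoService_lintegral {a : ℝ} (ha : 0 < a) :
    ∫⁻ t : ℝ≥0, ENNReal.ofReal (t : ℝ) ∂(paretoService a) = ENNReal.ofReal a := by
  have h1 := lintegral_excess_eq (paretoService a) 0
  rw [paretoService_lintegral_tail ha le_rfl] at h1
  simp only [sub_zero, add_zero, NNReal.coe_nonneg, max_eq_left] at h1
  rw [h1]
  congr 1
  field_simp

theorem meanService_paretoService {a : ℝ} (ha : 0 < a) : meanService (paretoService a) = a := by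
  rw [meanService, integral_eq_lintegral_of_nonneg_ae (ae_of_all _ fun t => t.2)
    NNReal.continuous_coe.measurable.aestronglyMeasurable, paretoService_lintegral ha,
    ENNReal.toReal_ofReal ha.le]

theorem isServiceLaw_paretoService {a : ℝ} (ha : 0 < a) : IsServiceLaw (paretoService a) := by
  refine ⟨inferInstance, ⟨NNReal.continuous_coe.measurable.aestronglyMeasurable, ?_⟩, ?_⟩
  · rw [hasFiniteIntegral_iff_ofReal (ae_of_all _ fun t => t.2), paretoService_lintegral ha]
    exact ENNReal.ofReal_lt_top
  · exact ha.trans_eq (meanService_paretoService ha).symm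

theorem equilibriumLaw_Iic (H : Measure ℝ≥0) : equilibriumLaw H (Iic 0) = 0 := by
  refine withDensity_absolutelyContinuous _ _ ?_
  rw [Measure.restrict_apply measurableSet_Iic, inter_comm, Ici_inter_Iic]
  simp

theorem equilibriumLaw_paretoService_Ioi {a : ℝ} (ha : 0 < a) {x : ℝ} (hx : 0 ≤ x) :
    equilibriumLaw (paretoService a) (Ioi x) = ENNReal.ofReal (a / (a + x)) := by
  rw [equilibriumLaw_Ioi _ (by rwa [meanService_paretoService ha]) hx,
    paretoService_lintegral_tail ha hx, meanService_paretoService ha,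
    ← ENNReal.ofReal_mul (by positivity)]
  congr 1
  field_simp

theorem tailProb_equilibriumLaw_paretoService {a : ℝ} (ha : 0 < a) {x : ℝ} (hx : 0 ≤ x) :
    tailProb (equilibriumLaw (paretoService a)) x = a / (a + x) := by
  rw [tailProb, measureReal_def, equilibriumLaw_paretoService_Ioi ha hx,
    ENNReal.toReal_ofReal (by positivity)]

theorem isProbabilityMeasure_equilibriumLaw_paretoService {a : ℝ} (ha : 0 < a) :
    IsProbabilityMeasure (equilibriumLaw (paretoService a)) := by
  refine ⟨?_⟩
  rw [← Iic_union_Ioi (a := (0 : ℝ)), measure_union (by simp) measurableSet_Ioi,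
    equilibriumLaw_Iic, equilibriumLaw_paretoService_Ioi ha le_rfl, add_zero, div_self ha.ne']
  simp

/-- One-big-jump argument for the tail `a / (a + x)`. The sum exceeds `x` only if one term exceeds
`(1 - ε) x` or both exceed `ε x`; the choice `ε = (a + x)^{-1/4}` makes both corrections vanish. -/
theorem isSubexponential_of_tailProb_eq {μ : Measure ℝ} [IsProbabilityMeasure μ]
    (h0 : μ (Iio 0) = 0) {a : ℝ} (ha : 0 < a) (hμ : ∀ x, 0 ≤ x → tailProb μ x = a / (a + x)) :
    IsSubexponential μ := by
  refine ⟨inferInstance, h0, fun x hx => by rw [hμ x hx]; positivity, ?_⟩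
  have hae : ∀ᵐ y ∂μ, 0 ≤ y := by
    rw [ae_iff]
    simpa [Iio] using h0
  have hae1 : ∀ᵐ z ∂(μ.prod μ), 0 ≤ z.1 := Measure.quasiMeasurePreserving_fst.ae hae
  have hae2 : ∀ᵐ z ∂(μ.prod μ), 0 ≤ z.2 := Measure.quasiMeasurePreserving_snd.ae hae
  have hadd : Tendsto (fun x : ℝ => a + x) atTop atTop :=
    tendsto_atTop_add_const_left atTop a tendsto_id
  have hs : Tendsto (fun x : ℝ => Real.sqrt (a + x)) atTop atTop :=
    Real.tendsto_sqrt_atTop.comp hadd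
  have hss : Tendsto (fun x : ℝ => Real.sqrt (Real.sqrt (a + x))) atTop atTop :=
    Real.tendsto_sqrt_atTop.comp hs
  have hε : Tendsto (fun x : ℝ => (Real.sqrt (Real.sqrt (a + x)))⁻¹) atTop (𝓝 0) :=
    tendsto_inv_atTop_zero.comp hss
  have hlow : Tendsto (fun x : ℝ => 2 - a / (a + x)) atTop (𝓝 2) := by
    simpa using (hadd.const_div_atTop a).const_sub 2
  have hup : Tendsto (fun x : ℝ => 2 / (1 - (Real.sqrt (Real.sqrt (a + x)))⁻¹) +
      a / Real.sqrt (a + x)) atTop (𝓝 2) := by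
    have h1 := ((tendsto_const_nhds (x := (2 : ℝ))).div (hε.const_sub 1) (by simp)).add
      (hs.const_div_atTop a)
    simpa using h1
  refine tendsto_of_tendsto_of_tendsto_of_le_of_le' hlow hup ?_ ?_
  · filter_upwards [eventually_ge_atTop 0] with x hx
    have hpos : 0 < a / (a + x) := by positivity
    rw [hμ x hx, le_div_iff₀ hpos, tailProb_conv]
    have h1 : (μ.prod μ).real (Ioi x ×ˢ univ ∪ univ ×ˢ Ioi x) ≤
        (μ.prod μ).real {z | x < z.1 + z.2} := by
      refine ENNReal.toReal_mono (measure_ne_top _ _) (measure_mono_ae ?_)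
      filter_upwards [hae1, hae2] with z h2 h3 hz
      change x < z.1 + z.2
      rcases hz with ⟨hz, _⟩ | ⟨_, hz⟩
      · have : x < z.1 := hz
        linarith
      · have : x < z.2 := hz
        linarith
    have h2 := measureReal_union_add_inter (μ := μ.prod μ) (s := Ioi x ×ˢ (univ : Set ℝ))
      (t := (univ : Set ℝ) ×ˢ Ioi x) (MeasurableSet.univ.prod measurableSet_Ioi)
    rw [prod_inter_prod, univ_inter, inter_univ, measureReal_prod_prod, measureReal_prod_prod,
      measureReal_prod_prod, probReal_univ, mul_one, one_mul] at h2
    have e : μ.real (Ioi x) = a / (a + x) := hμ x hx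
    rw [e] at h2
    nlinarith
  · filter_upwards [eventually_ge_atTop 0, hss.eventually_gt_atTop 1] with x hx hx1
    set s := Real.sqrt (a + x) with hsdef
    set ε := (Real.sqrt s)⁻¹ with hεdef
    have hss0 : 0 < Real.sqrt s := by linarith
    have hs0 : 0 < s := Real.sqrt_pos.1 hss0
    have hε0 : 0 < ε := by positivity
    have hε1 : ε < 1 := inv_lt_one_of_one_lt₀ hx1
    have hεs : ε ^ 2 * s = 1 := by
      rw [hεdef, inv_pow, Real.sq_sqrt hs0.le, inv_mul_cancel₀ hs0.ne']
    have hs2 : s ^ 2 = a + x := Real.sq_sqrt (by linarith)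
    have hpos : 0 < a / (a + x) := by positivity
    rw [hμ x hx, div_le_iff₀ hpos, tailProb_conv]
    have h1 : (μ.prod μ).real {z | x < z.1 + z.2} ≤
        (μ.prod μ).real (Ioi ((1 - ε) * x) ×ˢ univ ∪ univ ×ˢ Ioi ((1 - ε) * x) ∪
          Ioi (ε * x) ×ˢ Ioi (ε * x)) := by
      refine measureReal_mono fun z (hz : x < z.1 + z.2) => ?_
      by_cases c1 : (1 - ε) * x < z.1
      · exact Or.inl (Or.inl ⟨c1, mem_univ _⟩)
      by_cases c2 : (1 - ε) * x < z.2
      · exact Or.inl (Or.inr ⟨mem_univ _, c2⟩)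
      · refine Or.inr ⟨?_, ?_⟩
        · change ε * x < z.1
          linarith
        · change ε * x < z.2
          linarith
    have h2 := (measureReal_union_le (μ := μ.prod μ) (Ioi ((1 - ε) * x) ×ˢ univ ∪
      univ ×ˢ Ioi ((1 - ε) * x)) (Ioi (ε * x) ×ˢ Ioi (ε * x))).trans (add_le_add
        (measureReal_union_le _ _) le_rfl)
    rw [measureReal_prod_prod, measureReal_prod_prod, measureReal_prod_prod, probReal_univ,
      mul_one, one_mul] at h2
    have e1 : μ.real (Ioi ((1 - ε) * x)) = a / (a + (1 - ε) * x) :=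
      hμ _ (mul_nonneg (by linarith) hx)
    have e2 : μ.real (Ioi (ε * x)) = a / (a + ε * x) := hμ _ (by positivity)
    rw [e1, e2] at h2
    have h3 : a / (a + (1 - ε) * x) ≤ 1 / (1 - ε) * (a / (a + x)) := by
      have : 0 < 1 - ε := by linarith
      rw [one_div_mul_eq_div, div_div]
      refine div_le_div_of_nonneg_left ha.le (by positivity) ?_
      nlinarith
    have h4 : a / (a + ε * x) * (a / (a + ε * x)) ≤ a / s * (a / (a + x)) := by
      have h5 : a / (a + ε * x) ≤ a / (ε * (a + x)) := by
        refine div_le_div_of_nonneg_left ha.le (by positivity) ?_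
        nlinarith
      calc _ ≤ a / (ε * (a + x)) * (a / (ε * (a + x))) := by gcongr
        _ = a / (ε ^ 2 * s * s) * (a / (a + x)) := by
            rw [mul_assoc (ε ^ 2), ← sq s, hs2]
            field_simp
        _ = _ := by rw [hεs, one_mul]
    calc _ ≤ a / (a + (1 - ε) * x) + a / (a + (1 - ε) * x) +
          a / (a + ε * x) * (a / (a + ε * x)) := h1.trans h2
      _ ≤ 1 / (1 - ε) * (a / (a + x)) + 1 / (1 - ε) * (a / (a + x)) + a / s * (a / (a + x)) := by
          gcongr
      _ = _ := by ring

theorem isSubexponential_equilibriumLaw_paretoService {a : ℝ} (ha : 0 < a) :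
    IsSubexponential (equilibriumLaw (paretoService a)) := by
  have := isProbabilityMeasure_equilibriumLaw_paretoService ha
  exact isSubexponential_of_tailProb_eq
    (measure_mono_null Iio_subset_Iic_self (equilibriumLaw_Iic _)) ha
    fun x hx => tailProb_equilibriumLaw_paretoService ha hx

theorem isLongTailed_sqrt_equilibriumLaw_paretoService {a : ℝ} (ha : 0 < a) :
    IsLongTailed ((equilibriumLaw (paretoService a)).map Real.sqrt) := by
  have := isProbabilityMeasure_equilibriumLaw_paretoService ha
  have htail : ∀ x, 0 ≤ x → tailProb ((equilibriumLaw (paretoService a)).map Real.sqrt) x =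
      a / (a + x ^ 2) := fun x hx => by
    rw [tailProb_map_sqrt _ hx, tailProb_equilibriumLaw_paretoService ha (sq_nonneg x)]
  refine ⟨Measure.isProbabilityMeasure_map (by fun_prop), ?_, fun x hx => ?_, 1, one_pos, ?_⟩
  · rw [Measure.map_apply (by fun_prop) measurableSet_Iio]
    convert measure_empty (μ := equilibriumLaw (paretoService a))
    rw [Set.eq_empty_iff_forall_notMem]
    exact fun y hy => absurd (show Real.sqrt y < 0 from hy) (not_lt.2 (Real.sqrt_nonneg y))
  · rw [htail x hx]
    positivity
  · have hlow : Tendsto (fun x : ℝ => 1 - 2 / (x + 1)) atTop (𝓝 1) := by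
      simpa using ((tendsto_atTop_add_const_right atTop (1 : ℝ) tendsto_id).const_div_atTop
        2).const_sub 1
    refine tendsto_of_tendsto_of_tendsto_of_le_of_le' hlow tendsto_const_nhds ?_ ?_
    · filter_upwards [eventually_ge_atTop 0] with x hx
      rw [htail x hx, htail (x + 1) (by linarith), div_div_div_cancel_left' _ _ ha.ne',
        le_div_iff₀ (by positivity)]
      have h1 : (x + 1) * (2 / (x + 1)) = 2 := by field_simp
      have h2 : 0 ≤ 2 / (x + 1) := by positivity
      nlinarith [mul_nonneg ha.le h2]
    · filter_upwards [eventually_ge_atTop 0] with x hx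
      rw [htail x hx, htail (x + 1) (by linarith), div_div_div_cancel_left' _ _ ha.ne',
        div_le_one (by positivity)]
      nlinarith

/-! ### Heavy-tailed batches -/

/-- The batch rates `e^{-√k}`, `k ≥ 1`, of a process with a single phase. -/
noncomputable def weibullBatch (k : ℕ) : Matrix (Fin 1) (Fin 1) ℝ :=
  fun _ _ => if k = 0 then 0 else Real.exp (-Real.sqrt k)

theorem weibullBatch_nonneg (k : ℕ) (i j : Fin 1) : 0 ≤ weibullBatch k i j := by
  rw [weibullBatch]
  split_ifs
  · exact le_rfl
  · exact (Real.exp_pos _).le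

theorem weibullBatch_le (k : ℕ) (i j : Fin 1) : weibullBatch k i j ≤ Real.exp (-Real.sqrt k) := by
  rw [weibullBatch]
  split_ifs
  · exact (Real.exp_pos _).le
  · exact le_rfl

theorem summable_weibullBatch_pow (a : ℕ) (i j : Fin 1) :
    Summable fun k : ℕ => (k : ℝ) ^ a * weibullBatch k i j := by
  refine Summable.of_nonneg_of_le
    (fun k => mul_nonneg (by positivity) (weibullBatch_nonneg k i j)) (fun k => ?_)
    (summable_pow_mul_exp_neg_sqrt a one_pos)
  rw [neg_one_mul]
  exact mul_le_mul_of_nonneg_left (weibullBatch_le k i j) (by positivity)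

theorem summable_weibullBatch : Summable weibullBatch :=
  matrix_summable_iff.2 fun i j => by simpa using summable_weibullBatch_pow 0 i j

theorem weibullBatch_tsum_pos (a : ℕ) : 0 < ∑' k : ℕ, (k : ℝ) ^ a * weibullBatch k 0 0 :=
  (summable_weibullBatch_pow a 0 0).tsum_pos
    (fun k => mul_nonneg (by positivity) (weibullBatch_nonneg k 0 0)) 1
    (by simp [weibullBatch, Real.exp_pos])

theorem isBMAPParam_weibullBatch : IsBMAPParam (-∑' k, weibullBatch k) weibullBatch where
  C_diag i := by
    rw [Matrix.neg_apply, matrix_tsum_apply summable_weibullBatch, Subsingleton.elim i 0]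
    simpa using weibullBatch_tsum_pos 0
  C_offDiag i j hij := absurd (Subsingleton.elim i j) hij
  D_nonneg := weibullBatch_nonneg
  D_zero := by ext i j; simp [weibullBatch]
  D_summable := summable_weibullBatch
  row_sum := by simp
  irreducible i j := by rw [Subsingleton.elim i j]

theorem batchTailBound_weibullBatch : BatchTailBound weibullBatch := by
  have hs : Summable fun l : ℕ => Real.exp (-(1 / 2) * Real.sqrt l) := by
    simpa using summable_pow_mul_exp_neg_sqrt 0 (one_half_pos (α := ℝ))
  refine ⟨1 / 2, by norm_num, ∑' l : ℕ, Real.exp (-(1 / 2) * Real.sqrt l), fun k i j => ?_⟩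
  have hs' : Summable fun l => weibullBatch (k + 1 + l) := by
    simpa [add_comm] using (summable_nat_add_iff (k + 1)).2 summable_weibullBatch
  rw [seqTail, matrix_tsum_apply hs', ← tsum_mul_left]
  refine Summable.tsum_le_tsum (fun l => ?_) ((matrix_summable_iff.1 hs' i j).mul_left _) hs
  calc _ ≤ Real.exp (1 / 2 * Real.sqrt k) * Real.exp (-Real.sqrt (k + 1 + l : ℕ)) :=
        mul_le_mul_of_nonneg_left (weibullBatch_le _ i j) (Real.exp_pos _).le
    _ ≤ _ := by
        rw [← Real.exp_add]
        refine Real.exp_le_exp.2 ?_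
        have h1 : Real.sqrt k ≤ Real.sqrt (k + 1 + l : ℕ) :=
          Real.sqrt_le_sqrt (by exact_mod_cast (by omega : k ≤ k + 1 + l))
        have h2 : Real.sqrt l ≤ Real.sqrt (k + 1 + l : ℕ) :=
          Real.sqrt_le_sqrt (by exact_mod_cast (by omega : l ≤ k + 1 + l))
        linarith

theorem not_isLightTailedSeq_weibullBatch : ¬ IsLightTailedSeq weibullBatch := by
  rintro ⟨z, hz, hs⟩
  have h1 := ((matrix_summable_iff.1 hs 0 0).tendsto_atTop_zero).eventually
    (gt_mem_nhds (zero_lt_one (α := ℝ)))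
  have hlog : 0 < Real.log z := Real.log_pos hz
  have hsq : Tendsto (fun k : ℕ => Real.sqrt k) atTop atTop :=
    Real.tendsto_sqrt_atTop.comp tendsto_natCast_atTop_atTop
  obtain ⟨k, ⟨hk, hk2⟩, hk1⟩ := ((h1.and (hsq.eventually_ge_atTop (1 / Real.log z))).and
    (eventually_ge_atTop 1)).exists
  have hz0 : 0 < z := by linarith
  rw [Matrix.smul_apply, weibullBatch, if_neg (by omega), smul_eq_mul, ← Real.exp_log hz0,
    ← Real.exp_nat_mul, ← Real.exp_add, Real.exp_lt_one_iff] at hk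
  rw [div_le_iff₀ hlog] at hk2
  have h3 := Real.mul_self_sqrt (Nat.cast_nonneg (α := ℝ) k)
  have h4 := Real.sqrt_nonneg (k : ℝ)
  nlinarith

/-- Rates and service time that satisfy the hypotheses with batches that are not light-tailed. -/
theorem exists_subexpHypotheses_not_isLightTailedSeq :
    ∃ (m : ℕ) (C : Matrix (Fin m) (Fin m) ℝ) (D : ℕ → Matrix (Fin m) (Fin m) ℝ)
      (p : Fin m → ℝ) (H : Measure ℝ≥0),
      SubexpHypotheses C D p H ∧ arrivalRate p D * meanService H < 1 ∧
        ¬ IsLightTailedSeq D := by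
  have hrate : 0 < arrivalRate 1 weibullBatch := by
    have e : arrivalRate 1 weibullBatch = ∑' k : ℕ, (k : ℝ) ^ 1 * weibullBatch k 0 0 := by
      simp [arrivalRate, dotProduct, Matrix.mulVec,
        smul_tsum_apply fun i j => by simpa using summable_weibullBatch_pow 1 i j]
    rw [e]
    exact weibullBatch_tsum_pos 1
  have ha : 0 < 1 / (2 * arrivalRate 1 weibullBatch) := by positivity
  refine ⟨1, -∑' k, weibullBatch k, weibullBatch, 1,
    paretoService (1 / (2 * arrivalRate 1 weibullBatch)),
    ⟨isBMAPParam_weibullBatch, ⟨fun _ => zero_le_one, by simp, by simp⟩, hrate,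
      isServiceLaw_paretoService ha, isLongTailed_sqrt_equilibriumLaw_paretoService ha,
      batchTailBound_weibullBatch, isSubexponential_equilibriumLaw_paretoService ha⟩, ?_,
    not_isLightTailedSeq_weibullBatch⟩
  rw [meanService_paretoService ha]
  field_simp
  norm_num

/-! ### Asymptotics of the double tail -/

theorem mainTheorem5 :
    (∀ (Ω : Type*) [MeasurableSpace Ω] (m : ℕ) (C : Matrix (Fin m) (Fin m) ℝ)
      (D : ℕ → Matrix (Fin m) (Fin m) ℝ) (p : Fin m → ℝ) (H : Measure ℝ≥0)
      (P : Fin m → Measure Ω) (N : ℝ≥0 → Ω → ℕ) (J : ℝ≥0 → Ω → Fin m),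
      SubexpHypotheses C D p H → IsBMAP C D P N J →
        IsSubexponential ((equilibriumLaw H).map (fun x => arrivalRate p D * x)) ∧
        HasDoubleTailLimit (serviceArrivals P N J H)
          ((equilibriumLaw H).map (fun x => arrivalRate p D * x))
          (fun _ => arrivalRate p D * meanService H) ∧
        SubexpAssumption (serviceArrivals P N J H)
          ((equilibriumLaw H).map (fun x => ⌊arrivalRate p D * x⌋₊))
          (fun _ => arrivalRate p D * meanService H)) ∧
    (∃ (m : ℕ) (C : Matrix (Fin m) (Fin m) ℝ) (D : ℕ → Matrix (Fin m) (Fin m) ℝ)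
      (p : Fin m → ℝ) (H : Measure ℝ≥0),
      SubexpHypotheses C D p H ∧ arrivalRate p D * meanService H < 1 ∧
        ¬ IsLightTailedSeq D) := by
  refine ⟨?_, exists_subexpHypotheses_not_isLightTailedSeq⟩
  intro Ω _ m C D p H P N J hyp h
  have := hyp.equilibrium_subexp.prob
  have hlam := hyp.rate_pos
  have hh : 0 < meanService H := hyp.service.mean_pos
  have hsub := hyp.equilibrium_subexp.map_const_mul hlam
  have := hsub.prob
  have hlimit := h.hasDoubleTailLimit hyp
  have hlong : ∀ z, 0 ≤ z → Tendsto
      (fun x => tailProb ((equilibriumLaw H).map fun x => arrivalRate p D * x) (x + z) /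
        tailProb ((equilibriumLaw H).map fun x => arrivalRate p D * x) x) atTop (𝓝 1) := by
    intro z hz
    simp only [tailProb_map_const_mul _ hlam, add_div]
    exact (tendsto_tailProb_add_of_sqrt hyp.sqrt_longTailed
      (by positivity : 0 ≤ z / arrivalRate p D)).comp (tendsto_id.atTop_div_const hlam)
  have hfloor : ((equilibriumLaw H).map (fun x => ⌊arrivalRate p D * x⌋₊)).map
      (fun n : ℕ => (n : ℝ)) =
      ((equilibriumLaw H).map (fun x => arrivalRate p D * x)).map fun y => (⌊y⌋₊ : ℝ) := by
    rw [Measure.map_map (by fun_prop) (by fun_prop), Measure.map_map (by fun_prop) (by fun_prop)]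
    rfl
  refine ⟨hsub, hlimit, ?_, ?_, fun i => by positivity, ?_⟩
  · rw [hfloor]
    exact hsub.map_floor hlong
  · rw [hfloor]
    intro i
    have h1 := (tendsto_tailProb_floor_div hsub.tail_pos (hlong 1 zero_le_one)).comp
      tendsto_natCast_atTop_atTop
    have h2 := (hlimit i).mul (h1.inv₀ one_ne_zero)
    rw [inv_one, mul_one] at h2
    refine h2.congr fun k => ?_
    have h3 := (hsub.tail_pos k k.cast_nonneg).ne'
    simp only [Function.comp]
    rw [inv_div, div_mul_div_cancel₀ h3]
  · intro h0
    obtain ⟨i⟩ : Nonempty (Fin m) := by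
      by_contra hne
      rw [not_nonempty_iff] at hne
      simpa using hyp.stationary.sum_one
    have h1 : arrivalRate p D * meanService H = 0 := congrFun h0 i
    exact (mul_pos hlam hh).ne' h1
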